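/- Let $d$ be a natural number, let $\mathcal L^d$ be Lebesgue measure on $\mathbb R^d$, and let $(e_1,\dots,e_d)$ be the canonical basis. Let $\mathcal M$ be the set of Lebesgue measurable subsets of $\mathbb R^d$, two sets being identified when their symmetric difference is Lebesgue-negligible, with the topology of local convergence in measure ($A_k\to A$ iff $\mathcal L^d((A_k\Delta A)\cap U)\to 0$ for every bounded open $U$) and its Borel $\sigma$-algebra. A random measurable set (RAMS) is a random variable, defined on some probability space, with values in $\mathcal M$. Let $\mathcal W$ be the set of bounded open $W\subset\mathbb R^d$ with $\mathcal L^d(\partial W)=0$. For $y\in\mathbb R^d$, $W\in\mathcal W$, $A\in\mathcal M$ put $\delta_{y;W}(A)=\mathcal L^d(A\cap(y+A)\cap W)$. The mean local covariogram of a RAMS $X$ is $\gamma_X(y;W)=\mathbf E\,\delta_{y;W}(X)$. A function $\gamma:\mathbb R^d\times\mathcal W\to\mathbb R$ is admissible if for all $q\ge1$, $a_1,\dots,a_q\in\mathbb R$, $y_1,\dots,y_q\in\mathbb R^d$, $W_1,\dots,W_q\in\mathcal W$ and $c\in\mathbb R$, $$\Big[\forall A\in\mathcal M,\ c+\sum_{i=1}^q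 a_i\,\delta_{y_i;W_i}(A)\ge0\Big]\ \Longrightarrow\ c+\sum_{i=1}^q a_i\,\gamma(y_i;W_i)\ge0 .$$ For open $U\subset\mathbb R^d$ and $A\in\mathcal M$ let $$V_{e_j}(A;U)=\sup\Big\{\int_U \mathbf 1_A(x)\,\langle\nabla\varphi(x),e_j\rangle\,dx:\ \varphi\in C^1_c(U,\mathbb R),\ |\varphi|\le1\Big\}\in[0,\infty],\qquad \mathrm{Per}_{\mathbf B}(A;U)=\sum_{j=1}^d V_{e_j}(A;U),$$ and, with $U_n=(-n,n)^d$ and $\beta_n=2^{-n}(2n)^{-d}$ for $n\ge1$, $$\mathrm{Per}_{\mathbf B}^\beta(A)=\sum_{n\ge1}\beta_n\,\mathrm{Per}_{\mathbf B}(A;U_n).$$ Write $W\ominus B=\{x:\ x+B\subset W\}$ and, for $a,b\in\mathbb R^d$, let $[a,b]$ be the segment from $a$ to $b$. For $u\ne0$ and $W=U_n$ (in which case $W\ominus[-u,0]$ and $W\ominus[0,u]$ belong to $\mathcal W$), let $$\sigma_\gamma(u;W)=\frac1{\|u\|}\big[\gamma(0;W\ominus[-u,0])-\gamma(u;W\ominus[-u,0])+\gamma(0;W\ominus[0,u])-\gamma(-u;W\ominus[0,u])\big],$$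 and let $L_j(\gamma,U_n)\in[0,\infty]$ be the supremum over $\varepsilon\in\mathbb R\setminus\{0\}$ of the positive part of $\sigma_\gamma(\varepsilon e_j;U_n)$ (for admissible $\gamma$ one has $\sigma_\gamma(\varepsilon e_j;U_n)\ge 0$, so this is $\sup_{\varepsilon\neq0}\sigma_\gamma(\varepsilon e_j;U_n)$). Theorem. Let $\gamma:\mathbb R^d\times\mathcal W\to\mathbb R$ be a function and let $r\ge0$. Then there is a RAMS $X$ such that $\gamma(y;W)=\gamma_X(y;W)$ for all $(y,W)\in\mathbb R^d\times\mathcal W$ and $\mathbf E\,\mathrm{Per}_{\mathbf B}^\beta(X)\le r$ if and only if $\gamma$ is admissible and $$\sum_{n\ge1}\beta_n\Big(\sum_{j=1}^d L_j(\gamma,U_n)\Big)\le r .$$ -/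

import Mathlib

open MeasureTheory Set
open scoped ENNReal Topology

namespace RAMS

/-- `ℝ^d` with its Euclidean norm and Lebesgue measure. -/
abbrev E (d : ℕ) : Type := EuclideanSpace ℝ (Fin d)

/-- The canonical basis vector `e_j`. -/
noncomputable abbrev e {d : ℕ} (j : Fin d) : E d := EuclideanSpace.single j (1 : ℝ)

/-! ### Lebesgue classes of measurable sets -/

/-- Equality up to a Lebesgue-negligible symmetric difference, on Lebesgue measurable sets. -/
def aeSetoid (d : ℕ) : Setoid {A : Set (E d) // NullMeasurableSet A volume} where
  r A B := (A : Set (E d)) =ᵐ[volume] (B : Set (E d))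
  iseqv := ⟨fun _ => Filter.EventuallyEq.rfl, fun h => h.symm, fun h h' => h.trans h'⟩

/-- The space of Lebesgue measurable subsets of `ℝ^d`, modulo Lebesgue-negligible sets. -/
def M (d : ℕ) : Type := Quotient (aeSetoid d)

/-- The class of a Lebesgue measurable set. -/
def M.mk {d : ℕ} (A : Set (E d)) (hA : NullMeasurableSet A volume) : M d :=
  Quotient.mk (aeSetoid d) ⟨A, hA⟩

/-- `L^d((A Δ B) ∩ U)`. -/
noncomputable def localDist {d : ℕ} (U : Set (E d)) : M d → M d → ℝ≥0∞ :=
  Quotient.lift₂ (s₁ := aeSetoid d) (s₂ := aeSetoid d)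
    (fun A B => volume (symmDiff (A : Set (E d)) (B : Set (E d)) ∩ U))
    (fun A B A' B' (hA : (A : Set (E d)) =ᵐ[volume] (A' : Set (E d)))
      (hB : (B : Set (E d)) =ᵐ[volume] (B' : Set (E d))) => by
      refine measure_congr (Filter.EventuallyEq.inter ?_ Filter.EventuallyEq.rfl)
      exact (hA.diff hB).union (hB.diff hA))

/-- The topology of local convergence in measure: the topology generated by the open balls of the
pseudo-distances `(A, B) ↦ L^d((A Δ B) ∩ U)`, where `U` runs over the bounded open sets. -/
instance (d : ℕ) : TopologicalSpace (M d) :=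
  TopologicalSpace.generateFrom
    {S | ∃ (A : M d) (U : Set (E d)) (ε : ℝ≥0∞), IsOpen U ∧ Bornology.IsBounded U ∧ 0 < ε ∧
      S = {B : M d | localDist U A B < ε}}

/-- The Borel `σ`-algebra of local convergence in measure; a random measurable set is a measurable
map from a probability space to `M d`. -/
instance (d : ℕ) : MeasurableSpace (M d) := borel (M d)

instance (d : ℕ) : BorelSpace (M d) := ⟨rfl⟩

/-! ### Windows and local covariograms -/

/-- Observation windows: bounded open sets with Lebesgue-negligible boundary. -/
def IsWindow {d : ℕ} (W : Set (E d)) : Prop :=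
  Bornology.IsBounded W ∧ IsOpen W ∧ volume (frontier W) = 0

/-- The set of all observation windows. -/
abbrev Window (d : ℕ) : Type := {W : Set (E d) // IsWindow W}

/-- The local covariogram `δ_{y;W}(A) = L^d(A ∩ (y + A) ∩ W)` (a finite number). -/
noncomputable def localCovariogram {d : ℕ} (y : E d) (W : Window d) : M d → ℝ :=
  Quotient.lift (s := aeSetoid d)
    (fun A => (volume ((A : Set (E d)) ∩ ((fun x => y + x) '' (A : Set (E d))) ∩ W.1)).toReal)
    (fun A B (h : (A : Set (E d)) =ᵐ[volume] (B : Set (E d))) => by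
      refine congrArg ENNReal.toReal (measure_congr
        (Filter.EventuallyEq.inter (Filter.EventuallyEq.inter h ?_) Filter.EventuallyEq.rfl))
      rw [image_add_left, image_add_left]
      exact (measurePreserving_add_left volume (-y)).quasiMeasurePreserving.preimage_ae_eq h)

/-- The mean local covariogram `γ_X(y;W) = 𝐄 δ_{y;W}(X)`. -/
noncomputable def meanCovariogram {d : ℕ} {Ω : Type*} [MeasurableSpace Ω] (P : Measure Ω)
    (X : Ω → M d) (y : E d) (W : Window d) : ℝ :=
  ∫ ω, localCovariogram y W (X ω) ∂P

/-- Admissible functions `γ : ℝ^d × 𝒲 → ℝ`. -/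
def Admissible {d : ℕ} (γ : E d → Window d → ℝ) : Prop :=
  ∀ (q : ℕ), 1 ≤ q → ∀ (a : Fin q → ℝ) (y : Fin q → E d) (W : Fin q → Window d) (c : ℝ),
    (∀ A : M d, 0 ≤ c + ∑ i, a i * localCovariogram (y i) (W i) A) →
      0 ≤ c + ∑ i, a i * γ (y i) (W i)

/-! ### Perimeters -/

/-- The directional variation `V_u(A;U)` of (the indicator of) a set: the supremum of
`∫_U 1_A ⟨∇φ, u⟩` over `φ ∈ C¹_c(U, ℝ)` with `|φ| ≤ 1`. The choice `φ = 0` shows that the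
supremum is nonnegative. -/
noncomputable def setVariation {d : ℕ} (A : Set (E d)) (u : E d) (U : Set (E d)) : ℝ≥0∞ :=
  ⨆ (φ : E d → ℝ) (_ : ContDiff ℝ 1 φ ∧ HasCompactSupport φ ∧ tsupport φ ⊆ U ∧ ∀ x, |φ x| ≤ 1),
    ENNReal.ofReal (∫ x in U, A.indicator 1 x * fderiv ℝ φ x u)

/-- The directional variation `V_u(A;U)` of a Lebesgue class. -/
noncomputable def variation {d : ℕ} (u : E d) (U : Set (E d)) : M d → ℝ≥0∞ :=
  Quotient.lift (s := aeSetoid d) (fun A => setVariation (A : Set (E d)) u U)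
    (fun A B (h : (A : Set (E d)) =ᵐ[volume] (B : Set (E d))) => by
      refine iSup_congr fun φ => iSup_congr fun _ => congrArg ENNReal.ofReal (integral_congr_ae ?_)
      filter_upwards [ae_restrict_of_ae (indicator_ae_eq_of_ae_eq_set (f := (1 : E d → ℝ)) h)]
        with x hx
      rw [hx])

/-- The anisotropic perimeter `Per_𝐁(A;U) = ∑_j V_{e_j}(A;U)`. -/
noncomputable def perB {d : ℕ} (U : Set (E d)) (A : M d) : ℝ≥0∞ :=
  ∑ j : Fin d, variation (e j) U A

/-- The open cube `U_n = (-n, n)^d`. -/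
def cube (d : ℕ) (n : ℕ+) : Set (E d) := {x | ∀ i, x i ∈ Ioo (-(n : ℝ)) (n : ℝ)}

/-- The weights `β_n = 2^{-n} (2n)^{-d}`. -/
noncomputable def weight (d : ℕ) (n : ℕ+) : ℝ≥0∞ :=
  ENNReal.ofReal (((2 : ℝ) ^ (n : ℕ))⁻¹ * ((2 * (n : ℝ)) ^ d)⁻¹)

/-- The weighted anisotropic perimeter `Per_𝐁^β(A) = ∑_{n ≥ 1} β_n Per_𝐁(A;U_n)`. -/
noncomputable def perBeta {d : ℕ} (A : M d) : ℝ≥0∞ :=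
  ∑' n : ℕ+, weight d n * perB (cube d n) A

/-! ### Difference quotients and the constants `L_j` -/

/-- The Minkowski difference `A ⊖ B = {x : x + B ⊆ A}`. -/
def minkowskiDiff {d : ℕ} (A B : Set (E d)) : Set (E d) := {x | ∀ b ∈ B, x + b ∈ A}

theorem minkowskiDiff_eq_iInter {d : ℕ} (A B : Set (E d)) :
    minkowskiDiff A B = ⋂ b ∈ B, (fun x => x + b) ⁻¹' A := by
  ext x; simp [minkowskiDiff]

/-- A bounded convex open set is a window. -/
theorem isWindow_of_convex {d : ℕ} {W : Set (E d)} (hb : Bornology.IsBounded W) (ho : IsOpen W)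
    (hc : Convex ℝ W) : IsWindow W :=
  ⟨hb, ho, hc.addHaar_frontier volume⟩

/-- The Minkowski difference of a convex window and a segment is a window. -/
theorem isWindow_minkowskiDiff {d : ℕ} {W : Set (E d)} (hW : IsWindow W) (hc : Convex ℝ W)
    (a b : E d) : IsWindow (minkowskiDiff W (segment ℝ a b)) := by
  refine isWindow_of_convex ?_ ?_ ?_
  · have hb : Bornology.IsBounded ((fun x => -a + x) '' W) := by
      have := (isometry_add_left (-a)).lipschitz.isBounded_image hW.1
      exact this
    refine hb.subset fun x hx => ⟨x + a, hx a (left_mem_segment ℝ a b), by simp⟩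
  · have hK : IsCompact (segment ℝ a b) := by
      rw [segment_eq_image_lineMap]
      exact isCompact_Icc.image AffineMap.lineMap_continuous
    rw [← isClosed_compl_iff]
    have hcl : IsClosed {p : E d × segment ℝ a b | p.1 + (p.2 : E d) ∈ Wᶜ} :=
      hW.2.1.isClosed_compl.preimage (by fun_prop)
    have : CompactSpace (segment ℝ a b) := isCompact_iff_compactSpace.1 hK
    convert isClosedMap_fst_of_compactSpace _ hcl using 1
    ext x; simp [minkowskiDiff]
  · rw [minkowskiDiff_eq_iInter]
    exact convex_iInter₂ fun v _ => by
      simpa using hc.translate_preimage_left v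

theorem cube_convex (d : ℕ) (n : ℕ+) : Convex ℝ (cube d n) := by
  have : cube d n = ⋂ i, (EuclideanSpace.proj (𝕜 := ℝ) i : E d →L[ℝ] ℝ) ⁻¹'
      Ioo (-(n : ℝ)) (n : ℝ) := by
    ext x; simp [cube]
  rw [this]
  exact convex_iInter fun i => (convex_Ioo _ _).linear_preimage
    (EuclideanSpace.proj (𝕜 := ℝ) i : E d →L[ℝ] ℝ).toLinearMap

theorem isWindow_cube (d : ℕ) (n : ℕ+) : IsWindow (cube d n) := by
  refine isWindow_of_convex ?_ ?_ (cube_convex d n)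
  · refine (Metric.isBounded_closedBall (x := (0 : E d)) (r := √(∑ _i : Fin d, (n : ℝ) ^ 2))).subset
      fun x hx => ?_
    rw [mem_closedBall_zero_iff, EuclideanSpace.norm_eq]
    refine Real.sqrt_le_sqrt (Finset.sum_le_sum fun i _ => ?_)
    rw [Real.norm_eq_abs, sq_abs]
    exact sq_le_sq' (hx i).1.le (hx i).2.le
  · have : cube d n = ⋂ i, (fun x : E d => x i) ⁻¹' Ioo (-(n : ℝ)) (n : ℝ) := by
      ext x; simp [cube]
    rw [this]
    exact isOpen_iInter_of_finite fun i => isOpen_Ioo.preimage (by fun_prop)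

/-- The window `W ⊖ [a, b]`, for a convex window `W`. -/
def erode {d : ℕ} (W : Window d) (hc : Convex ℝ W.1) (a b : E d) : Window d :=
  ⟨minkowskiDiff W.1 (segment ℝ a b), isWindow_minkowskiDiff W.2 hc a b⟩

/-- The difference quotient `σ_γ(u;W)`, for a convex window `W` (so that `W ⊖ [-u,0]` and
`W ⊖ [0,u]` are windows). -/
noncomputable def sigma {d : ℕ} (γ : E d → Window d → ℝ) (u : E d) (W : Window d)
    (hc : Convex ℝ W.1) : ℝ :=
  1 / ‖u‖ * (γ 0 (erode W hc (-u) 0) - γ u (erode W hc (-u) 0)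
    + γ 0 (erode W hc 0 u) - γ (-u) (erode W hc 0 u))

/-- `L_j(γ,W) = sup_{ε ≠ 0} σ_γ(ε e_j;W) ∈ [0,∞]`, for a convex window `W`. For an admissible `γ`
all the difference quotients are nonnegative; in general, negative ones are counted as `0`. -/
noncomputable def L {d : ℕ} (j : Fin d) (γ : E d → Window d → ℝ) (W : Window d)
    (hc : Convex ℝ W.1) : ℝ≥0∞ :=
  ⨆ (ε : ℝ) (_ : ε ≠ 0), ENNReal.ofReal (sigma γ (ε • e j) W hc)

end RAMS

/-!
Let `J_u(S; W)` be the volume of the points `x` such that `x` and `x - u` lie in `W` and exactly one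
of them lies in `S`. For convex `W` the difference quotient `σ` of the covariograms of `S` is
`J_u(S; W) / ‖u‖` (`sigma_localCovariogram_mk`). It is at most the directional variation, by testing
the variation against functions close to the sign of the jump (`jumpVol_le_setVariation`). Since
`J_{2u} ≤ 2 J_u` by convexity, it increases along `u = 2⁻ᵐ e_j`, and its limit is the directional
variation (`variation_eq_iSup`). Hence the mean variation of a random set is the supremum of the
dyadic difference quotients of its mean covariogram (`lintegral_variation`), and it dominates
`L_j` of the mean covariogram (`L_meanCovariogram_le`). This gives the necessity of the condition,
as the covariogram of a random set is admissible by integration.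

For the sufficiency, let `γ` be admissible with weighted sum of the `L_j` at most `r`.

* By Hahn–Banach separation in finite dimension, `γ` is approximated at finitely many arguments by
  convex combinations of covariograms of sets (`Admissible.exists_convex_approx`). Among these
  arguments one can include those of the difference quotients at scale `2⁻ᵏ` on the first cubes; on
  the other cubes these quotients are small because of the weights
  (`Admissible.exists_convex_approx_quotient`).
* These sets need not have finite perimeter. A set is therefore replaced by the union of the grid
  cells of side `2⁻ᵏ` whose sampling point lies in it, the grid being shifted by a uniform random
  offset. This does not change the covariogram at grid vectors, up to a boundary effect, and the mean
  variation of the pixelated set is controlled by the difference quotient at scale `2⁻ᵏ`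
  (`exists_sampling_law`). The outcome is a law close to `γ` at finitely many grid vectors, whose
  mean weighted variation is bounded independently of `k` (`Admissible.exists_approx_law`).
* Sets with bounded variations on all cubes form a compact subset of `M d`
  (`isCompact_variation_le`), so that the laws are tight. By Prokhorov's theorem and the continuity of
  the covariograms there is a law whose mean covariogram equals `γ` at all dyadic vectors
  (`Admissible.exists_law`).
* The mean variation of this law only depends on its covariogram at dyadic vectors, so it is at most
  `L_j`. In particular both `γ` and the mean covariogram have finite `L_j`, and admissibility makes
  them Lipschitz in each coordinate (`Admissible.abs_sub_le`). They agree at dyadic vectors, hence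
  everywhere (`Admissible.eq_of_eq_dyadic`).
-/

namespace RAMS

variable {d : ℕ}

/-! ### Representatives, local covariograms and jump sets -/

/-- Every Lebesgue class has a Borel representative. -/
theorem M.exists_rep (A : M d) :
    ∃ (S : Set (E d)) (hS : MeasurableSet S), A = M.mk S hS.nullMeasurableSet := by
  induction A using Quotient.inductionOn with
  | h S =>
    obtain ⟨T, -, hT, hTS⟩ := S.2.exists_measurable_superset_ae_eq
    exact ⟨T, hT, Quotient.sound (s := aeSetoid d) hTS.symm⟩

theorem localDist_mk {U S T : Set (E d)} (hS : NullMeasurableSet S volume)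
    (hT : NullMeasurableSet T volume) :
    localDist U (M.mk S hS) (M.mk T hT) = volume (symmDiff S T ∩ U) := rfl

theorem variation_mk {U S : Set (E d)} (u : E d) (hS : NullMeasurableSet S volume) :
    variation u U (M.mk S hS) = setVariation S u U := rfl

theorem localCovariogram_mk (y : E d) (W : Window d) {S : Set (E d)}
    (hS : NullMeasurableSet S volume) :
    localCovariogram y W (M.mk S hS) = volume.real {x | x ∈ S ∧ x - y ∈ S ∧ x ∈ W.1} := by
  change (volume (S ∩ ((fun x => y + x) '' S) ∩ W.1)).toReal = _
  rw [image_add_left, Measure.real]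
  congr 2
  ext x
  simp only [mem_inter_iff, mem_preimage, mem_ofPred_eq, sub_eq_neg_add]
  tauto

theorem Window.volume_ne_top (W : Window d) : volume W.1 ≠ ∞ := W.2.1.measure_lt_top.ne

theorem Window.measurableSet (W : Window d) : MeasurableSet W.1 := W.2.2.1.measurableSet

theorem localCovariogram_nonneg (y : E d) (W : Window d) (A : M d) :
    0 ≤ localCovariogram y W A := by
  obtain ⟨S, hS, rfl⟩ := A.exists_rep
  rw [localCovariogram_mk]
  exact measureReal_nonneg

theorem localCovariogram_le (y : E d) (W : Window d) (A : M d) :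
    localCovariogram y W A ≤ volume.real W.1 := by
  obtain ⟨S, hS, rfl⟩ := A.exists_rep
  rw [localCovariogram_mk]
  exact measureReal_mono (fun x hx => hx.2.2) W.volume_ne_top

/-- The volume of the points `x` such that `x` and `x - u` lie in `W` and exactly one of them
lies in `S`. -/
noncomputable def jumpVol (S : Set (E d)) (u : E d) (W : Set (E d)) : ℝ≥0∞ :=
  volume {x | x ∈ W ∧ x - u ∈ W ∧ ¬(x ∈ S ↔ x - u ∈ S)}

theorem jumpVol_le (S : Set (E d)) (u : E d) (W : Set (E d)) : jumpVol S u W ≤ volume W :=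
  measure_mono fun _ hx => hx.1

theorem jumpVol_two_smul_le (S : Set (E d)) (u : E d) {W : Set (E d)} (hc : Convex ℝ W) :
    jumpVol S ((2 : ℝ) • u) W ≤ 2 * jumpVol S u W := by
  have hsub : {x | x ∈ W ∧ x - (2 : ℝ) • u ∈ W ∧ ¬(x ∈ S ↔ x - (2 : ℝ) • u ∈ S)} ⊆
      {x | x ∈ W ∧ x - u ∈ W ∧ ¬(x ∈ S ↔ x - u ∈ S)} ∪
        (fun x => x + (-u)) ⁻¹' {x | x ∈ W ∧ x - u ∈ W ∧ ¬(x ∈ S ↔ x - u ∈ S)} := by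
    rintro x ⟨h1, h2, h3⟩
    have hm : x - u ∈ W := by
      have := hc h1 h2 (a := 1 / 2) (b := 1 / 2) (by norm_num) (by norm_num) (by norm_num)
      convert this using 1
      module
    have h4 : x + (-u) - u = x - (2 : ℝ) • u := by module
    simp only [mem_union, mem_ofPred_eq, mem_preimage, h4]
    rw [← sub_eq_add_neg]
    tauto
  calc jumpVol S ((2 : ℝ) • u) W ≤ _ := measure_mono hsub
    _ ≤ _ := measure_union_le _ _
    _ = _ := by rw [measure_preimage_add_right, two_mul]; rfl

theorem mem_minkowskiDiff_segment {W : Set (E d)} (hc : Convex ℝ W) {x a b : E d} :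
    x ∈ minkowskiDiff W (segment ℝ a b) ↔ x + a ∈ W ∧ x + b ∈ W := by
  refine ⟨fun h => ⟨h a (left_mem_segment ℝ a b), h b (right_mem_segment ℝ a b)⟩, ?_⟩
  rintro ⟨ha, hb⟩ c ⟨s, t, hs, ht, hst, rfl⟩
  have := hc ha hb hs ht hst
  convert this using 1
  rw [smul_add, smul_add, add_add_add_comm, ← add_smul, hst, one_smul]

/-- The difference quotient of the covariograms of a set is its normalised jump volume. -/
theorem sigma_localCovariogram_mk {S : Set (E d)} (hS : MeasurableSet S) (u : E d) (W : Window d)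
    (hc : Convex ℝ W.1) :
    sigma (fun y W' => localCovariogram y W' (M.mk S hS.nullMeasurableSet)) u W hc =
      1 / ‖u‖ * (jumpVol S u W.1).toReal := by
  have hWm := W.measurableSet
  have hsm : MeasurableSet ((fun x => x - u) ⁻¹' S) := hS.preimage (by fun_prop)
  have hsm' : MeasurableSet ((fun x => x - u) ⁻¹' W.1) := hWm.preimage (by fun_prop)
  have key : ∀ v : E d, localCovariogram 0 (erode W hc (-v) 0) (M.mk S hS.nullMeasurableSet) -
      localCovariogram v (erode W hc (-v) 0) (M.mk S hS.nullMeasurableSet) =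
      volume.real {x | x ∈ W.1 ∧ x - v ∈ W.1 ∧ x ∈ S ∧ x - v ∉ S} := by
    intro v
    have hsv : MeasurableSet ((fun x => x - v) ⁻¹' S) := hS.preimage (by fun_prop)
    have hsv' : MeasurableSet ((fun x => x - v) ⁻¹' W.1) := hWm.preimage (by fun_prop)
    rw [localCovariogram_mk, localCovariogram_mk]
    simp only [erode, mem_minkowskiDiff_segment hc, add_zero, ← sub_eq_add_neg, sub_zero]
    have hsub : {x | x ∈ S ∧ x - v ∈ S ∧ x - v ∈ W.1 ∧ x ∈ W.1} ⊆
      {x | x ∈ S ∧ x ∈ S ∧ x - v ∈ W.1 ∧ x ∈ W.1} := fun x hx => ⟨hx.1, hx.1, hx.2.2⟩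
    rw [← measureReal_sdiff hsub (hS.inter (hsv.inter (hsv'.inter hWm)))
      (measure_ne_top_of_subset (fun x hx => hx.2.2.2) W.volume_ne_top)]
    congr 1
    ext x
    simp only [mem_sdiff, mem_ofPred_eq]
    tauto
  have hsw : erode W hc 0 u = erode W hc (-(-u)) 0 := by
    unfold erode
    congr 2
    rw [neg_neg, segment_symm]
  have hneg : volume.real {x | x ∈ W.1 ∧ x - -u ∈ W.1 ∧ x ∈ S ∧ x - -u ∉ S} =
      volume.real {x | x ∈ W.1 ∧ x - u ∈ W.1 ∧ x ∉ S ∧ x - u ∈ S} := by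
    unfold Measure.real
    rw [← measure_preimage_add_right volume (-u)]
    congr 2
    ext x
    simp only [preimage_ofPred_eq, mem_ofPred_eq, ← sub_eq_add_neg, sub_neg_eq_add, sub_add_cancel]
    tauto
  unfold sigma
  rw [add_sub_assoc, hsw, key u, key (-u), hneg, ← measureReal_union
    (s₂ := {x | x ∈ W.1 ∧ x - u ∈ W.1 ∧ x ∉ S ∧ x - u ∈ S})
    (Set.disjoint_left.2 fun x hx hx' => hx'.2.2.1 hx.2.2.1)
    (hWm.inter (hsm'.inter (hS.compl.inter hsm)))
    (measure_ne_top_of_subset (fun x hx => hx.1) W.volume_ne_top)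
    (measure_ne_top_of_subset (fun x hx => hx.1) W.volume_ne_top)]
  unfold jumpVol Measure.real
  congr 3
  ext x
  simp only [mem_union, mem_ofPred_eq]
  tauto

theorem measurableSet_jump {S W : Set (E d)} (hS : MeasurableSet S) (hW : MeasurableSet W)
    (u : E d) : MeasurableSet {x | x ∈ W ∧ x - u ∈ W ∧ ¬(x ∈ S ↔ x - u ∈ S)} := by
  have h1 : MeasurableSet ((fun x => x - u) ⁻¹' S) := hS.preimage (by fun_prop)
  have h2 : MeasurableSet ((fun x => x - u) ⁻¹' W) := hW.preimage (by fun_prop)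
  have h3 : {x | x ∈ W ∧ x - u ∈ W ∧ ¬(x ∈ S ↔ x - u ∈ S)} =
      W ∩ ((fun x => x - u) ⁻¹' W ∩ ((S \ (fun x => x - u) ⁻¹' S) ∪
        ((fun x => x - u) ⁻¹' S \ S))) := by
    ext x
    simp only [mem_inter_iff, mem_union, mem_sdiff, mem_preimage, mem_ofPred_eq]
    tauto
  rw [h3]
  exact hW.inter (h2.inter ((hS.diff h1).union (h1.diff hS)))

/-! ### Continuity for local convergence in measure -/

theorem eventually_localDist_lt (A : M d) {U : Set (E d)} (hU : IsOpen U)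
    (hb : Bornology.IsBounded U) {ε : ℝ≥0∞} (hε : 0 < ε) : ∀ᶠ B in 𝓝 A, localDist U A B < ε := by
  refine IsOpen.mem_nhds (TopologicalSpace.isOpen_generateFrom_of_mem ⟨A, U, ε, hU, hb, hε, rfl⟩) ?_
  obtain ⟨S, hS, rfl⟩ := A.exists_rep
  simpa [localDist_mk] using hε

theorem continuous_localCovariogram (y : E d) (W : Window d) :
    Continuous (localCovariogram y W) := by
  rw [continuous_iff_continuousAt]
  intro A
  rw [ContinuousAt, Metric.tendsto_nhds]
  intro ε hε
  have hW' : IsOpen ((fun x => x + y) ⁻¹' W.1) := W.2.2.1.preimage (by fun_prop)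
  have hb' : Bornology.IsBounded ((fun x => x + y) ⁻¹' W.1) := by
    have := (isometry_add_right (-y)).lipschitz.isBounded_image W.2.1
    refine this.subset fun x hx => ⟨x + y, hx, by simp⟩
  have hε' : 0 < ENNReal.ofReal (ε / 2) := ENNReal.ofReal_pos.2 (half_pos hε)
  filter_upwards [eventually_localDist_lt A W.2.2.1 W.2.1 hε',
    eventually_localDist_lt A hW' hb' hε'] with B h1 h2
  obtain ⟨S, hS, rfl⟩ := A.exists_rep
  obtain ⟨T, hT, rfl⟩ := B.exists_rep
  rw [localDist_mk] at h1 h2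
  rw [localCovariogram_mk, localCovariogram_mk, Real.dist_eq, abs_sub_comm]
  have hfin : ∀ S : Set (E d), volume {x | x ∈ S ∧ x - y ∈ S ∧ x ∈ W.1} ≠ ∞ := fun S =>
    measure_ne_top_of_subset (fun x hx => hx.2.2) W.volume_ne_top
  have hm : ∀ S : Set (E d), MeasurableSet S →
      MeasurableSet {x | x ∈ S ∧ x - y ∈ S ∧ x ∈ W.1} := fun S hS =>
    hS.inter ((hS.preimage (by fun_prop : Measurable fun x : E d => x - y)).inter W.measurableSet)
  refine lt_of_le_of_lt (abs_measureReal_sub_le_measureReal_symmDiff' (hm S hS).nullMeasurableSet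
    (hm T hT).nullMeasurableSet (hfin S) (hfin T)) ?_
  rw [Measure.real, ← ENNReal.ofReal_lt_ofReal_iff hε, ENNReal.ofReal_toReal
    (measure_symmDiff_ne_top (hfin S) (hfin T))]
  calc volume (symmDiff {x | x ∈ S ∧ x - y ∈ S ∧ x ∈ W.1} {x | x ∈ T ∧ x - y ∈ T ∧ x ∈ W.1})
      ≤ volume ((symmDiff S T ∩ W.1) ∪ (fun x => x + (-y)) ⁻¹'
          (symmDiff S T ∩ (fun x => x + y) ⁻¹' W.1)) := by
        refine measure_mono fun x hx => ?_
        simp only [mem_symmDiff, mem_ofPred_eq, mem_union, mem_inter_iff, mem_preimage,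
          ← sub_eq_add_neg, sub_add_cancel] at hx ⊢
        tauto
    _ ≤ _ := measure_union_le _ _
    _ < ENNReal.ofReal (ε / 2) + ENNReal.ofReal (ε / 2) := by
        rw [measure_preimage_add_right]
        exact ENNReal.add_lt_add h1 h2
    _ = ENNReal.ofReal ε := by
        rw [← ENNReal.ofReal_add (by positivity) (by positivity), add_halves]

theorem continuous_sigma (u : E d) (W : Window d) (hc : Convex ℝ W.1) :
    Continuous fun A : M d => sigma (fun y W' => localCovariogram y W' A) u W hc := by
  have := fun y (W : Window d) => continuous_localCovariogram y W
  unfold sigma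
  fun_prop

theorem integrable_localCovariogram {Ω : Type*} [MeasurableSpace Ω] (P : Measure Ω)
    [IsFiniteMeasure P] {X : Ω → M d} (hX : Measurable X) (y : E d) (W : Window d) :
    Integrable (fun ω => localCovariogram y W (X ω)) P := by
  refine Integrable.of_bound ((continuous_localCovariogram y W).measurable.comp
    hX).aestronglyMeasurable (volume.real W.1) (ae_of_all _ fun ω => ?_)
  rw [Real.norm_of_nonneg (localCovariogram_nonneg _ _ _)]
  exact localCovariogram_le _ _ _

theorem sigma_meanCovariogram {Ω : Type*} [MeasurableSpace Ω] (P : Measure Ω)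
    [IsFiniteMeasure P] {X : Ω → M d} (hX : Measurable X) (u : E d) (W : Window d)
    (hc : Convex ℝ W.1) :
    sigma (meanCovariogram P X) u W hc =
      ∫ ω, sigma (fun y W' => localCovariogram y W' (X ω)) u W hc ∂P := by
  have hi := fun y W => integrable_localCovariogram P hX y W
  unfold sigma meanCovariogram
  rw [integral_const_mul, integral_sub, integral_add, integral_sub]
  all_goals first
    | exact hi _ _
    | exact (hi _ _).sub (hi _ _)
    | exact ((hi _ _).sub (hi _ _)).add (hi _ _)

theorem sigma_localCovariogram_nonneg (A : M d) (u : E d) (W : Window d) (hc : Convex ℝ W.1) :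
    0 ≤ sigma (fun y W' => localCovariogram y W' A) u W hc := by
  obtain ⟨S, hS, rfl⟩ := A.exists_rep
  rw [sigma_localCovariogram_mk hS]
  positivity

theorem admissible_meanCovariogram {Ω : Type*} [MeasurableSpace Ω] (P : Measure Ω)
    [IsProbabilityMeasure P] {X : Ω → M d} (hX : Measurable X) :
    Admissible (meanCovariogram P X) := by
  intro q _ a y W c h
  have hi := fun i => (integrable_localCovariogram P hX (y i) (W i)).const_mul (a i)
  have : c + ∑ i, a i * meanCovariogram P X (y i) (W i) =
      ∫ ω, (c + ∑ i, a i * localCovariogram (y i) (W i) (X ω)) ∂P := by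
    rw [integral_add (integrable_const c) (integrable_finsetSum _ fun i _ => hi i),
      integral_finsetSum _ fun i _ => hi i]
    simp [meanCovariogram, integral_const_mul]
  rw [this]
  exact integral_nonneg fun ω => h (X ω)

/-! ### Directional variation and difference quotients -/

/-- The admissible test functions in the definition of the directional variation on `U`. -/
def IsTest (φ : E d → ℝ) (U : Set (E d)) : Prop :=
  ContDiff ℝ 1 φ ∧ HasCompactSupport φ ∧ tsupport φ ⊆ U ∧ ∀ x, |φ x| ≤ 1

theorem IsTest.neg {φ : E d → ℝ} {U : Set (E d)} (h : IsTest φ U) : IsTest (-φ) U := by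
  refine ⟨h.1.neg, by simpa [HasCompactSupport, tsupport_neg] using h.2.1, ?_,
    fun x => by simpa using h.2.2.2 x⟩
  rw [tsupport_neg]
  exact h.2.2.1

theorem IsTest.comp_add_right {φ : E d → ℝ} {U U' : Set (E d)} (h : IsTest φ U) {v : E d}
    (hv : ∀ x, x + v ∈ U → x ∈ U') : IsTest (fun x => φ (x + v)) U' := by
  refine ⟨h.1.comp (by fun_prop), h.2.1.comp_homeomorph (Homeomorph.addRight v), ?_,
    fun x => h.2.2.2 _⟩
  have : tsupport (fun x => φ (x + v)) = (Homeomorph.addRight v) ⁻¹' tsupport φ :=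
    tsupport_comp_eq_preimage φ (Homeomorph.addRight v)
  rw [this]
  exact fun x hx => hv x (h.2.2.1 hx)

theorem setIntegral_test {φ : E d → ℝ} {U : Set (E d)} (h : IsTest φ U) (S : Set (E d))
    (u : E d) : ∫ x in U, S.indicator 1 x * fderiv ℝ φ x u =
      ∫ x, S.indicator 1 x * fderiv ℝ φ x u := by
  refine setIntegral_eq_integral_of_forall_compl_eq_zero fun x hx => ?_
  have : fderiv ℝ φ x = 0 := by
    by_contra h0
    exact hx (h.2.2.1 (support_fderiv_subset ℝ h0))
  simp [this]

theorem integral_test_le {φ : E d → ℝ} {U : Set (E d)} (h : IsTest φ U) (S : Set (E d))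
    (u : E d) : ENNReal.ofReal (∫ x, S.indicator 1 x * fderiv ℝ φ x u) ≤ setVariation S u U := by
  rw [← setIntegral_test h]
  exact le_iSup₂_of_le φ h le_rfl

theorem abs_integral_test_le {φ : E d → ℝ} {U : Set (E d)} (h : IsTest φ U) (S : Set (E d))
    (u : E d) : ENNReal.ofReal |∫ x, S.indicator 1 x * fderiv ℝ φ x u| ≤ setVariation S u U := by
  rcases abs_choice (∫ x, S.indicator 1 x * fderiv ℝ φ x u) with h0 | h0
  · rw [h0]
    exact integral_test_le h S u
  · rw [h0, ← integral_neg]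
    have := integral_test_le h.neg S u
    simpa [fderiv_neg] using this

theorem setVariation_smul_le (S : Set (E d)) (u : E d) (U : Set (E d)) (c : ℝ) :
    setVariation S (c • u) U ≤ ENNReal.ofReal |c| * setVariation S u U := by
  refine iSup₂_le fun φ hφ => ?_
  rw [setIntegral_test hφ]
  have : ∫ x, S.indicator 1 x * fderiv ℝ φ x (c • u) =
      c * ∫ x, S.indicator 1 x * fderiv ℝ φ x u := by
    rw [← integral_const_mul]
    congr 1 with x
    rw [map_smul, smul_eq_mul]
    ring
  rw [this]
  calc ENNReal.ofReal (c * ∫ x, S.indicator 1 x * fderiv ℝ φ x u)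
      ≤ ENNReal.ofReal (|c| * |∫ x, S.indicator 1 x * fderiv ℝ φ x u|) := by
        rw [← abs_mul]
        exact ENNReal.ofReal_le_ofReal (le_abs_self _)
    _ ≤ _ := by
        rw [ENNReal.ofReal_mul (abs_nonneg _)]
        gcongr
        exact abs_integral_test_le hφ S u

theorem integrable_indicator_mul {S : Set (E d)} (hS : MeasurableSet S) {g : E d → ℝ}
    (hg : Continuous g) (hc : HasCompactSupport g) :
    Integrable fun x => S.indicator (1 : E d → ℝ) x * g x := by
  have h := (hg.integrable_of_hasCompactSupport (μ := volume) hc).indicator hS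
  refine h.congr (ae_of_all _ fun x => ?_)
  by_cases hx : x ∈ S <;> simp [hx]

/-- Translating a test function: the derivative of the pairing with the indicator of `S`. -/
theorem hasDerivAt_integral_translate {S : Set (E d)} (hS : MeasurableSet S) {φ : E d → ℝ}
    (h1 : ContDiff ℝ 1 φ) (h2 : HasCompactSupport φ) (u : E d) (t : ℝ) :
    HasDerivAt (fun s : ℝ => ∫ x, S.indicator (1 : E d → ℝ) x * φ (x + s • u))
      (∫ x, S.indicator (1 : E d → ℝ) x * fderiv ℝ φ (x + t • u) u) t := by
  have hd : Continuous fun x => fderiv ℝ φ x u :=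
    (h1.continuous_fderiv (by norm_num)).clm_apply continuous_const
  have hdc : HasCompactSupport fun x => fderiv ℝ φ x u := by
    refine h2.mono' fun x hx => ?_
    refine support_fderiv_subset ℝ fun h0 => hx ?_
    simp [h0]
  obtain ⟨C, hC⟩ := hd.bounded_above_of_compact_support hdc
  set K : Set (E d) := (fun p : E d × ℝ => p.1 - p.2 • u) '' (tsupport φ ×ˢ Icc (t - 1) (t + 1))
    with hK
  have hKc : IsCompact K := (h2.prod isCompact_Icc).image (by fun_prop)
  have hcomp : ∀ s : ℝ, HasCompactSupport fun x => φ (x + s • u) := fun s =>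
    h2.comp_homeomorph (Homeomorph.addRight (s • u))
  have hcomp' : HasCompactSupport fun x => fderiv ℝ φ (x + t • u) u :=
    hdc.comp_homeomorph (Homeomorph.addRight (t • u))
  refine (hasDerivAt_integral_of_dominated_loc_of_deriv_le (𝕜 := ℝ)
    (F := fun s x => S.indicator (1 : E d → ℝ) x * φ (x + s • u))
    (F' := fun s x => S.indicator (1 : E d → ℝ) x * fderiv ℝ φ (x + s • u) u)
    (bound := K.indicator fun _ => C) (s := Icc (t - 1) (t + 1))
    (Icc_mem_nhds (by linarith) (by linarith)) ?_ ?_ ?_ ?_ ?_ ?_).2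
  · refine Filter.Eventually.of_forall fun s => (integrable_indicator_mul hS ?_ (hcomp s)).1
    exact h1.continuous.comp (by fun_prop)
  · exact integrable_indicator_mul hS (h1.continuous.comp (by fun_prop)) (hcomp t)
  · exact (integrable_indicator_mul hS (hd.comp (by fun_prop)) hcomp').1
  · refine ae_of_all _ fun x s hs => ?_
    by_cases hx : fderiv ℝ φ (x + s • u) u = 0
    · simp only [hx, mul_zero, norm_zero]
      exact indicator_nonneg (fun _ _ => (norm_nonneg _).trans (hC 0)) x
    · have hxK : x ∈ K := by
        refine ⟨(x + s • u, s), ⟨?_, hs⟩, by simp⟩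
        refine support_fderiv_subset ℝ fun h0 => hx ?_
        simp [h0]
      rw [indicator_of_mem hxK, norm_mul]
      calc _ ≤ 1 * C := by
            gcongr
            · by_cases hxS : x ∈ S <;> simp [hxS]
            · exact hC _
        _ = C := one_mul C
  · exact (integrable_indicator_iff hKc.measurableSet).2
      (integrableOn_const hKc.measure_lt_top.ne)
  · refine ae_of_all _ fun x s _ => HasDerivAt.const_mul _ ?_
    have hφ : HasFDerivAt φ (fderiv ℝ φ (x + s • u)) (x + s • u) :=
      (h1.differentiable (by norm_num) _).hasFDerivAt
    have hl : HasDerivAt (fun r : ℝ => x + r • u) u s := by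
      simpa using ((hasDerivAt_id s).smul_const u).const_add x
    exact hφ.comp_hasDerivAt s hl

theorem integral_translate_sub {S : Set (E d)} (hS : MeasurableSet S) {φ : E d → ℝ}
    (h1 : Continuous φ) (h2 : HasCompactSupport φ) (v : E d) :
    (∫ x, S.indicator (1 : E d → ℝ) x * φ (x + v)) - ∫ x, S.indicator (1 : E d → ℝ) x * φ x =
      ∫ x, (S.indicator (1 : E d → ℝ) (x - v) - S.indicator (1 : E d → ℝ) x) * φ x := by
  have hsv : MeasurableSet ((fun x => x - v) ⁻¹' S) := hS.preimage (by fun_prop)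
  have h3 : ∫ x, S.indicator (1 : E d → ℝ) x * φ (x + v) =
      ∫ x, S.indicator (1 : E d → ℝ) (x - v) * φ x := by
    rw [← integral_sub_right_eq_self (fun x => S.indicator (1 : E d → ℝ) x * φ (x + v)) v]
    simp
  have h4 : Integrable fun x => S.indicator (1 : E d → ℝ) (x - v) * φ x :=
    integrable_indicator_mul hsv h1 h2
  rw [h3, ← integral_sub h4 (integrable_indicator_mul hS h1 h2)]
  simp only [sub_mul]

theorem abs_indicator_sub_mul_le {S W : Set (E d)} {φ : E d → ℝ} (hφ : ∀ x, |φ x| ≤ 1)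
    {v : E d} (hs : ∀ x, φ x ≠ 0 → x ∈ W ∧ x - v ∈ W) (x : E d) :
    |(S.indicator (1 : E d → ℝ) (x - v) - S.indicator (1 : E d → ℝ) x) * φ x| ≤
      {x | x ∈ W ∧ x - v ∈ W ∧ ¬(x ∈ S ↔ x - v ∈ S)}.indicator 1 x := by
  by_cases h0 : φ x = 0
  · rw [h0, mul_zero, abs_zero]
    exact indicator_nonneg (fun _ _ => zero_le_one) x
  · have hx := hs x h0
    have := hφ x
    by_cases h1 : x ∈ S <;> by_cases h2 : x - v ∈ S <;> simp [hx.1, hx.2, h1, h2, this]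

/-- The variation is at most the limit of the normalised jump volumes along dyadic steps. -/
theorem setVariation_le_iSup_jumpVol {S W : Set (E d)} (hS : MeasurableSet S) (hW : IsOpen W)
    (hWf : volume W ≠ ∞) (u : E d) :
    setVariation S u W ≤ ⨆ m : ℕ, (2 : ℝ≥0∞) ^ m * jumpVol S ((2⁻¹ : ℝ) ^ m • u) W := by
  refine iSup₂_le fun φ (hφ : IsTest φ W) => ?_
  rw [setIntegral_test hφ]
  have hG := hasDerivAt_integral_translate hS hφ.1 hφ.2.1 u 0
  simp only [zero_smul, add_zero] at hG
  have hlim : Filter.Tendsto (fun m : ℕ => (2⁻¹ : ℝ) ^ m) Filter.atTop (𝓝[≠] 0) := by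
    refine tendsto_nhdsWithin_iff.2 ⟨tendsto_pow_atTop_nhds_zero_of_lt_one (by norm_num)
      (by norm_num), Filter.Eventually.of_forall fun m => ?_⟩
    simp
  have hslope := (hasDerivAt_iff_tendsto_slope.1 hG).comp hlim
  refine le_of_tendsto ((ENNReal.continuous_ofReal.tendsto _).comp hslope) ?_
  obtain ⟨δ, hδ, hth⟩ := hφ.2.1.exists_thickening_subset_open hW hφ.2.2.1
  have hsmall : ∀ᶠ m : ℕ in Filter.atTop, ‖(2⁻¹ : ℝ) ^ m • u‖ < δ := by
    have h0 : Filter.Tendsto (fun m : ℕ => ‖(2⁻¹ : ℝ) ^ m • u‖) Filter.atTop (𝓝 0) := by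
      have := (tendsto_nhdsWithin_iff.1 hlim).1
      simpa using (this.smul_const u).norm
    exact h0.eventually_lt_const hδ
  filter_upwards [hsmall] with m hm
  refine le_iSup_of_le m ?_
  have hs : ∀ x, φ x ≠ 0 → x ∈ W ∧ x - (2⁻¹ : ℝ) ^ m • u ∈ W := by
    intro x hx
    have hxt : x ∈ tsupport φ := subset_tsupport φ hx
    refine ⟨hφ.2.2.1 hxt, hth ?_⟩
    rw [Metric.mem_thickening_iff]
    exact ⟨x, hxt, by simpa [dist_eq_norm] using hm⟩
  have hJm := measurableSet_jump hS hW.measurableSet ((2⁻¹ : ℝ) ^ m • u)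
  have hJf : volume {x | x ∈ W ∧ x - (2⁻¹ : ℝ) ^ m • u ∈ W ∧
      ¬(x ∈ S ↔ x - (2⁻¹ : ℝ) ^ m • u ∈ S)} ≠ ∞ := ((jumpVol_le S _ W).trans_lt hWf.lt_top).ne
  have hbd : ∫ x, (S.indicator (1 : E d → ℝ) (x - (2⁻¹ : ℝ) ^ m • u) -
      S.indicator (1 : E d → ℝ) x) * φ x ≤ (jumpVol S ((2⁻¹ : ℝ) ^ m • u) W).toReal := by
    have h1 := norm_integral_le_of_norm_le (μ := volume)
      (f := fun x => (S.indicator (1 : E d → ℝ) (x - (2⁻¹ : ℝ) ^ m • u) -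
        S.indicator (1 : E d → ℝ) x) * φ x)
      ((integrable_indicator_iff hJm).2 (integrableOn_const (C := (1 : ℝ)) hJf))
      (ae_of_all _ (abs_indicator_sub_mul_le (S := S) hφ.2.2.2 hs))
    refine (le_abs_self _).trans (h1.trans_eq ?_)
    rw [integral_indicator hJm, setIntegral_const]
    simp [jumpVol, Measure.real]
  simp only [Function.comp_apply, slope_def_field, zero_smul, add_zero]
  rw [integral_translate_sub hS hφ.1.continuous hφ.2.1, sub_zero, div_eq_inv_mul, inv_pow, inv_inv,
    ENNReal.ofReal_mul (by positivity), ENNReal.ofReal_pow (by norm_num), ENNReal.ofReal_ofNat]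
  gcongr
  rw [inv_pow] at hbd
  exact ENNReal.ofReal_le_of_le_toReal hbd

/-- A smooth function equal to `1` and `-1` on two given disjoint compact sets. -/
theorem exists_test_separating {W K₁ K₂ : Set (E d)} (hW : IsOpen W) (h₁ : IsCompact K₁)
    (h₂ : IsCompact K₂) (h₁W : K₁ ⊆ W) (h₂W : K₂ ⊆ W) (hd : Disjoint K₁ K₂) :
    ∃ φ : E d → ℝ, IsTest φ W ∧ (∀ x ∈ K₁, φ x = 1) ∧ ∀ x ∈ K₂, φ x = -1 := by
  obtain ⟨V, hVo, hKV, hVW, hVc⟩ := exists_open_between_and_isCompact_closure (h₁.union h₂) hW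
    (union_subset h₁W h₂W)
  have aux : ∀ K K' : Set (E d), IsCompact K → IsCompact K' → K ⊆ V → Disjoint K K' →
      ∃ f : E d → ℝ, ContDiff ℝ 1 f ∧ range f ⊆ Icc 0 1 ∧ Function.support f = V ∩ K'ᶜ ∧
        ∀ x ∈ K, f x = 1 := by
    intro K K' hK hK' hKV hKK'
    obtain ⟨f, hf, hr, hs, h1⟩ := exists_contMDiff_support_eq_eq_one_iff (n := 1)
      (modelWithCornersSelf ℝ (E d)) (hVo.inter hK'.isClosed.isOpen_compl) hK.isClosed
      (subset_inter hKV hKK'.subset_compl_right)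
    exact ⟨f, hf.contDiff, hr, hs, fun x hx => (h1 x).1 hx⟩
  obtain ⟨f, hf, hfr, hfs, hf1⟩ := aux K₁ K₂ h₁ h₂ (subset_union_left.trans hKV) hd
  obtain ⟨g, hg, hgr, hgs, hg1⟩ := aux K₂ K₁ h₂ h₁ (subset_union_right.trans hKV) hd.symm
  have hsub : Function.support (f - g) ⊆ V := by
    intro x hx
    by_contra hxV
    have h1 : f x = 0 := by
      by_contra h0
      exact hxV (hfs ▸ (show x ∈ Function.support f from h0)).1
    have h2 : g x = 0 := by
      by_contra h0
      exact hxV (hgs ▸ (show x ∈ Function.support g from h0)).1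
    exact hx (by simp [h1, h2])
  refine ⟨f - g, ⟨hf.sub hg, HasCompactSupport.of_support_subset_isCompact hVc
    (hsub.trans subset_closure), (closure_mono hsub).trans hVW, fun x => ?_⟩, ?_, ?_⟩
  · have a := hfr (mem_range_self x)
    have b := hgr (mem_range_self x)
    rw [Pi.sub_apply, abs_le]
    constructor <;> linarith [a.1, a.2, b.1, b.2]
  · intro x hx
    have : g x = 0 := by
      by_contra h0
      exact (hgs ▸ (show x ∈ Function.support g from h0)).2 hx
    simp [hf1 x hx, this]
  · intro x hx
    have : f x = 0 := by
      by_contra h0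
      exact (hfs ▸ (show x ∈ Function.support f from h0)).2 hx
    simp [hg1 x hx, this]

/-- The jump volume along a vector is at most the variation in that direction. By duality it is the
supremum of `∫ (1_S(x) - 1_S(x - u)) φ(x)` over test functions `φ`, and moving the translation onto
`φ` expresses each of these as the increment of `t ↦ ∫ 1_S(x) φ(x + t u)` on `[0, 1]`. -/
theorem jumpVol_le_setVariation {S W : Set (E d)} (hS : MeasurableSet S) (hW : IsOpen W)
    (hWf : volume W ≠ ∞) (hc : Convex ℝ W) (u : E d) :
    jumpVol S u W ≤ setVariation S u W := by
  by_cases hV : setVariation S u W = ∞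
  · simp [hV]
  set J := {x | x ∈ W ∧ x - u ∈ W ∧ ¬(x ∈ S ↔ x - u ∈ S)} with hJ
  have hJm : MeasurableSet J := measurableSet_jump hS hW.measurableSet u
  have hJf : volume J ≠ ∞ := ((jumpVol_le S u W).trans_lt hWf.lt_top).ne
  have key : ∀ ε : ℝ, 0 < ε → volume.real J ≤ (setVariation S u W).toReal + 4 * ε := by
    intro ε hε
    have hε' : ENNReal.ofReal ε ≠ 0 := by simpa using hε
    -- The two kinds of jumps are exhausted by compact sets, on which `φ` is `1` and `-1`.
    obtain ⟨K₁, hK₁, hK₁c, hK₁v⟩ := (hJm.inter hS).exists_isCompact_sdiff_lt (μ := volume)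
      (measure_ne_top_of_subset inter_subset_left hJf) hε'
    obtain ⟨K₂, hK₂, hK₂c, hK₂v⟩ := (hJm.diff hS).exists_isCompact_sdiff_lt (μ := volume)
      (measure_ne_top_of_subset sdiff_subset hJf) hε'
    set W' := W ∩ (fun x => x - u) ⁻¹' W with hW'
    have hW'o : IsOpen W' := hW.inter (hW.preimage (by fun_prop))
    have hJW' : J ⊆ W' := fun x hx => ⟨hx.1, hx.2.1⟩
    obtain ⟨φ, hφ, hφ1, hφ2⟩ := exists_test_separating hW'o hK₁c hK₂c
      (hK₁.trans (inter_subset_left.trans hJW')) (hK₂.trans (sdiff_subset.trans hJW'))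
      (Set.disjoint_left.2 fun x h1 h2 => (hK₂ h2).2 (hK₁ h1).2)
    have hmvt := norm_image_sub_le_of_norm_deriv_le_segment_01'
      (f := fun s : ℝ => ∫ x, S.indicator (1 : E d → ℝ) x * φ (x + s • u))
      (C := (setVariation S u W).toReal)
      (fun t _ => (hasDerivAt_integral_translate hS hφ.1 hφ.2.1 u t).hasDerivWithinAt)
      (fun t ht => by
        have htest : IsTest (fun x => φ (x + t • u)) W := hφ.comp_add_right fun x hx => by
          have := hc hx.1 hx.2 (a := 1 - t) (b := t) (by linarith [ht.2]) ht.1 (by ring)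
          convert this using 1
          module
        have := abs_integral_test_le htest S u
        simp only [fderiv_comp_add_right] at this
        rw [Real.norm_eq_abs]
        exact (ENNReal.ofReal_le_iff_le_toReal hV).1 this)
    simp only [one_smul, zero_smul, add_zero] at hmvt
    rw [integral_translate_sub hS hφ.1.continuous hφ.2.1] at hmvt
    set K := K₁ ∪ K₂ with hK
    have hKJ : K ⊆ J := union_subset (hK₁.trans inter_subset_left) (hK₂.trans sdiff_subset)
    have hKm : MeasurableSet K := (hK₁c.union hK₂c).measurableSet
    have hKf : volume K ≠ ∞ := measure_ne_top_of_subset hKJ hJf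
    have hJKf : volume (J \ K) ≠ ∞ := measure_ne_top_of_subset sdiff_subset hJf
    have hJK : volume.real (J \ K) ≤ 2 * ε := by
      refine ENNReal.toReal_le_of_le_ofReal (by positivity) ?_
      calc volume (J \ K) ≤ volume ((J ∩ S) \ K₁ ∪ (J \ S) \ K₂) := by
            refine measure_mono fun x hx => ?_
            simp only [hK, mem_sdiff, mem_union, mem_inter_iff] at hx ⊢
            tauto
        _ ≤ ENNReal.ofReal ε + ENNReal.ofReal ε :=
            (measure_union_le _ _).trans (add_le_add hK₁v.le hK₂v.le)
        _ = ENNReal.ofReal (2 * ε) := by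
            rw [← ENNReal.ofReal_add hε.le hε.le, two_mul]
    have hsum : volume.real J = volume.real K + volume.real (J \ K) := by
      rw [measureReal_sdiff hKJ hKm hJf]
      ring
    have hint : volume.real K - volume.real (J \ K) ≤
        -∫ x, (S.indicator (1 : E d → ℝ) (x - u) - S.indicator (1 : E d → ℝ) x) * φ x := by
      have e1 : ∫ x, (K.indicator (1 : E d → ℝ) x - (J \ K).indicator (1 : E d → ℝ) x) =
          volume.real K - volume.real (J \ K) := by
        rw [integral_sub, integral_indicator_one hKm, integral_indicator_one (hJm.diff hKm)]
        · exact (integrable_indicator_iff hKm).2 (integrableOn_const hKf)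
        · exact (integrable_indicator_iff (hJm.diff hKm)).2 (integrableOn_const hJKf)
      rw [← e1, ← integral_neg]
      have hsv : MeasurableSet ((fun x => x - u) ⁻¹' S) := hS.preimage (by fun_prop)
      refine integral_mono_ae ?_ ?_ (ae_of_all _ fun x => ?_)
      · exact ((integrable_indicator_iff hKm).2 (integrableOn_const hKf)).sub
          ((integrable_indicator_iff (hJm.diff hKm)).2 (integrableOn_const hJKf))
      · refine Integrable.neg ?_
        simp only [sub_mul]
        exact (integrable_indicator_mul hsv hφ.1.continuous hφ.2.1).sub
          (integrable_indicator_mul hS hφ.1.continuous hφ.2.1)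
      · by_cases hx1 : x ∈ K₁
        · have hxS : x ∈ S := (hK₁ hx1).2
          have hxJ : x ∈ J := (hK₁ hx1).1
          have hxu : x - u ∉ S := fun h => hxJ.2.2 ⟨fun _ => h, fun _ => hxS⟩
          simp [hK, hx1, hxS, hxu, hφ1 x hx1]
        by_cases hx2 : x ∈ K₂
        · have hxS : x ∉ S := (hK₂ hx2).2
          have hxJ : x ∈ J := (hK₂ hx2).1
          have hxu : x - u ∈ S := by
            by_contra h
            exact hxJ.2.2 ⟨fun h' => absurd h' hxS, fun h' => absurd h' h⟩
          simp [hK, hx2, hxS, hxu, hφ2 x hx2]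
        have hxK : x ∉ K := fun h => h.elim hx1 hx2
        have hs : ∀ x, φ x ≠ 0 → x ∈ W ∧ x - u ∈ W := fun x hx =>
          hφ.2.2.1 (subset_tsupport φ hx)
        have h3 := abs_indicator_sub_mul_le (S := S) hφ.2.2.2 hs x
        have h4 : (J \ K).indicator (1 : E d → ℝ) x = J.indicator 1 x := by
          by_cases hxJ : x ∈ J <;> simp [hxJ, hxK]
        beta_reduce
        rw [indicator_of_notMem hxK, h4]
        have := le_abs_self
          ((S.indicator (1 : E d → ℝ) (x - u) - S.indicator (1 : E d → ℝ) x) * φ x)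
        linarith
    have h5 := neg_le_abs
      (∫ x, (S.indicator (1 : E d → ℝ) (x - u) - S.indicator (1 : E d → ℝ) x) * φ x)
    rw [Real.norm_eq_abs] at hmvt
    linarith
  have hle : volume.real J ≤ (setVariation S u W).toReal := by
    refine le_of_forall_pos_le_add fun ε hε => ?_
    have := key (ε / 4) (by positivity)
    linarith
  exact (ENNReal.toReal_le_toReal hJf hV).1 hle

theorem norm_e (j : Fin d) : ‖(e j : E d)‖ = 1 := by simp [e]

theorem ofReal_sigma_le_variation (A : M d) (j : Fin d) (W : Window d) (hc : Convex ℝ W.1)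
    {ε : ℝ} (hε : ε ≠ 0) :
    ENNReal.ofReal (sigma (fun y W' => localCovariogram y W' A) (ε • e j) W hc) ≤
      variation (e j) W.1 A := by
  obtain ⟨S, hS, rfl⟩ := A.exists_rep
  have hε' : 0 < |ε| := abs_pos.2 hε
  have hjf : jumpVol S (ε • e j) W.1 ≠ ∞ :=
    ((jumpVol_le S _ _).trans_lt W.volume_ne_top.lt_top).ne
  rw [sigma_localCovariogram_mk hS, variation_mk, norm_smul, norm_e, mul_one, Real.norm_eq_abs,
    ENNReal.ofReal_mul (by positivity), ENNReal.ofReal_toReal hjf, one_div,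
    ENNReal.ofReal_inv_of_pos hε', mul_comm, ← div_eq_mul_inv]
  refine ENNReal.div_le_of_le_mul ?_
  rw [mul_comm]
  exact (jumpVol_le_setVariation hS W.2.2.1 W.volume_ne_top hc _).trans
    (setVariation_smul_le S _ _ _)

theorem ofReal_sigma_dyadic {S : Set (E d)} (hS : MeasurableSet S) (j : Fin d) (W : Window d)
    (hc : Convex ℝ W.1) (m : ℕ) :
    ENNReal.ofReal (sigma (fun y W' => localCovariogram y W' (M.mk S hS.nullMeasurableSet))
      ((2⁻¹ : ℝ) ^ m • e j) W hc) =
      (2 : ℝ≥0∞) ^ m * jumpVol S ((2⁻¹ : ℝ) ^ m • e j) W.1 := by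
  have hjf : jumpVol S ((2⁻¹ : ℝ) ^ m • e j) W.1 ≠ ∞ :=
    ((jumpVol_le S _ _).trans_lt W.volume_ne_top.lt_top).ne
  rw [sigma_localCovariogram_mk hS, ENNReal.ofReal_mul (by positivity), ENNReal.ofReal_toReal hjf,
    norm_smul, norm_e, mul_one, norm_pow, norm_inv, Real.norm_ofNat, one_div, inv_pow, inv_inv,
    ENNReal.ofReal_pow (by norm_num), ENNReal.ofReal_ofNat]

theorem monotone_dyadic_jumpVol (S : Set (E d)) (u : E d) {W : Set (E d)} (hc : Convex ℝ W) :
    Monotone fun m : ℕ => (2 : ℝ≥0∞) ^ m * jumpVol S ((2⁻¹ : ℝ) ^ m • u) W := by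
  refine monotone_nat_of_le_succ fun m => ?_
  have h := jumpVol_two_smul_le S ((2⁻¹ : ℝ) ^ (m + 1) • u) hc
  have h2 : (2 : ℝ) • (2⁻¹ : ℝ) ^ (m + 1) • u = (2⁻¹ : ℝ) ^ m • u := by
    rw [smul_smul, pow_succ]
    congr 1
    ring
  rw [h2] at h
  calc (2 : ℝ≥0∞) ^ m * jumpVol S ((2⁻¹ : ℝ) ^ m • u) W
      ≤ 2 ^ m * (2 * jumpVol S ((2⁻¹ : ℝ) ^ (m + 1) • u) W) := by gcongr
    _ = _ := by rw [pow_succ (2 : ℝ≥0∞), mul_assoc]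

theorem monotone_sigma_dyadic (A : M d) (j : Fin d) (W : Window d) (hc : Convex ℝ W.1) :
    Monotone fun m : ℕ => ENNReal.ofReal
      (sigma (fun y W' => localCovariogram y W' A) ((2⁻¹ : ℝ) ^ m • e j) W hc) := by
  obtain ⟨S, hS, rfl⟩ := A.exists_rep
  simp only [ofReal_sigma_dyadic hS]
  exact monotone_dyadic_jumpVol S _ hc

/-- The directional variation is the increasing limit of the dyadic difference quotients. -/
theorem variation_eq_iSup (A : M d) (j : Fin d) (W : Window d) (hc : Convex ℝ W.1) :
    variation (e j) W.1 A = ⨆ m : ℕ, ENNReal.ofReal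
      (sigma (fun y W' => localCovariogram y W' A) ((2⁻¹ : ℝ) ^ m • e j) W hc) := by
  refine le_antisymm ?_ (iSup_le fun m => ofReal_sigma_le_variation A j W hc (by positivity))
  obtain ⟨S, hS, rfl⟩ := A.exists_rep
  simp only [ofReal_sigma_dyadic hS]
  exact setVariation_le_iSup_jumpVol hS W.2.2.1 W.volume_ne_top _

theorem measurable_variation (j : Fin d) (W : Window d) (hc : Convex ℝ W.1) :
    Measurable fun A : M d => variation (e j) W.1 A := by
  simp only [variation_eq_iSup _ j W hc]
  exact Measurable.iSup fun m =>
    (ENNReal.continuous_ofReal.comp (continuous_sigma _ W hc)).measurable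

theorem isClosed_variation_le (j : Fin d) (W : Window d) (hc : Convex ℝ W.1) (c : ℝ≥0∞) :
    IsClosed {A : M d | variation (e j) W.1 A ≤ c} := by
  simp only [variation_eq_iSup _ j W hc, iSup_le_iff, ofPred_forall]
  exact isClosed_iInter fun m => isClosed_le
    (ENNReal.continuous_ofReal.comp (continuous_sigma _ W hc)) continuous_const

/-- The mean variation of a random set is computed from its mean covariogram. -/
theorem lintegral_variation {Ω : Type*} [MeasurableSpace Ω] (P : Measure Ω)
    [IsFiniteMeasure P] {X : Ω → M d} (hX : Measurable X) (j : Fin d) (W : Window d)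
    (hc : Convex ℝ W.1) :
    ∫⁻ ω, variation (e j) W.1 (X ω) ∂P = ⨆ m : ℕ, ENNReal.ofReal
      (sigma (meanCovariogram P X) ((2⁻¹ : ℝ) ^ m • e j) W hc) := by
  simp only [variation_eq_iSup _ j W hc]
  have hm : ∀ m : ℕ, Measurable fun ω => ENNReal.ofReal
      (sigma (fun y W' => localCovariogram y W' (X ω)) ((2⁻¹ : ℝ) ^ m • e j) W hc) := fun m =>
    (ENNReal.continuous_ofReal.comp (continuous_sigma _ W hc)).measurable.comp hX
  rw [lintegral_iSup hm
    (fun m m' h ω => monotone_sigma_dyadic (X ω) j W hc h)]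
  refine iSup_congr fun m => ?_
  rw [sigma_meanCovariogram P hX, ofReal_integral_eq_lintegral_ofReal]
  · have hi := fun y W => integrable_localCovariogram P hX y W
    unfold sigma
    exact ((((hi _ _).sub (hi _ _)).add (hi _ _)).sub (hi _ _)).const_mul _
  · exact ae_of_all _ fun ω => sigma_localCovariogram_nonneg _ _ _ _

/-- The constants `L_j` of a mean covariogram are bounded by the mean variation. -/
theorem L_meanCovariogram_le {Ω : Type*} [MeasurableSpace Ω] (P : Measure Ω)
    [IsFiniteMeasure P] {X : Ω → M d} (hX : Measurable X) (j : Fin d) (W : Window d)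
    (hc : Convex ℝ W.1) :
    L j (meanCovariogram P X) W hc ≤ ∫⁻ ω, variation (e j) W.1 (X ω) ∂P := by
  refine iSup₂_le fun ε hε => ?_
  rw [sigma_meanCovariogram P hX, ofReal_integral_eq_lintegral_ofReal]
  · exact lintegral_mono fun ω => ofReal_sigma_le_variation (X ω) j W hc hε
  · have hi := fun y W => integrable_localCovariogram P hX y W
    unfold sigma
    exact ((((hi _ _).sub (hi _ _)).add (hi _ _)).sub (hi _ _)).const_mul _
  · exact ae_of_all _ fun ω => sigma_localCovariogram_nonneg _ _ _ _

/-! ### Cubes and weights -/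

theorem cube_mono {n m : ℕ+} (h : n ≤ m) : cube d n ⊆ cube d m := by
  intro x hx i
  have h' : (n : ℝ) ≤ (m : ℝ) := by exact_mod_cast h
  exact ⟨by linarith [(hx i).1], by linarith [(hx i).2]⟩

theorem measurableSet_cube (n : ℕ+) : MeasurableSet (cube d n) :=
  (isWindow_cube d n).2.1.measurableSet

theorem exists_subset_cube {U : Set (E d)} (hU : Bornology.IsBounded U) :
    ∃ n : ℕ+, U ⊆ cube d n := by
  obtain ⟨R, hR⟩ := hU.subset_closedBall 0
  obtain ⟨k, hk⟩ := exists_nat_gt (max R 0)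
  have hk0 : 0 < k := by
    have : (0 : ℝ) < k := (le_max_right R 0).trans_lt hk
    exact_mod_cast this
  refine ⟨⟨k, hk0⟩, fun x hx i => ?_⟩
  have h1 : ‖x i‖ ≤ ‖x‖ := PiLp.norm_apply_le x i
  have h2 : ‖x‖ ≤ R := by simpa using hR hx
  have h3 := abs_lt.1 ((Real.norm_eq_abs _ ▸ h1.trans h2).trans_lt ((le_max_left R 0).trans_lt hk))
  exact h3

theorem iUnion_cube : ⋃ n, cube d n = univ := by
  refine eq_univ_of_forall fun x => ?_
  obtain ⟨n, hn⟩ := exists_subset_cube (Bornology.isBounded_singleton (x := x))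
  exact mem_iUnion.2 ⟨n, hn rfl⟩

theorem volume_cube (n : ℕ+) : volume (cube d n) = ENNReal.ofReal ((2 * (n : ℝ)) ^ d) := by
  have h : cube d n = WithLp.ofLp ⁻¹' (univ.pi fun _ : Fin d => Ioo (-(n : ℝ)) (n : ℝ)) := by
    ext x
    simp [cube]
  rw [h, (PiLp.volume_preserving_ofLp (Fin d)).measure_preimage
    (MeasurableSet.univ_pi fun _ => measurableSet_Ioo).nullMeasurableSet, Real.volume_pi_Ioo]
  rw [Finset.prod_const, Finset.card_univ, Fintype.card_fin, ← ENNReal.ofReal_pow (by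
    have : (0 : ℝ) < n := by exact_mod_cast n.pos
    linarith)]
  congr 2
  ring

theorem weight_ne_zero (n : ℕ+) : weight d n ≠ 0 := by
  have : (0 : ℝ) < n := by exact_mod_cast n.pos
  exact (ENNReal.ofReal_pos.2 (by positivity)).ne'

theorem weight_ne_top (n : ℕ+) : weight d n ≠ ∞ := ENNReal.ofReal_ne_top

theorem weight_mul_volume_cube (n : ℕ+) :
    weight d n * volume (cube d n) = (2⁻¹ : ℝ≥0∞) ^ (n : ℕ) := by
  have : (0 : ℝ) < n := by exact_mod_cast n.pos
  rw [weight, volume_cube, ← ENNReal.ofReal_mul (by positivity), mul_assoc,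
    inv_mul_cancel₀ (by positivity), mul_one, ← inv_pow, ENNReal.ofReal_pow (by norm_num),
    ENNReal.ofReal_inv_of_pos (by norm_num), ENNReal.ofReal_ofNat]

theorem one_le_volume_cube (n : ℕ+) : 1 ≤ volume (cube d n) := by
  rw [volume_cube, ENNReal.one_le_ofReal]
  have : (1 : ℝ) ≤ n := by exact_mod_cast n.pos
  exact one_le_pow₀ (by linarith)

theorem tsum_two_inv_pow_le : ∑' n : ℕ+, (2⁻¹ : ℝ≥0∞) ^ (n : ℕ) ≤ 2 := by
  refine (ENNReal.tsum_comp_le_tsum_of_injective PNat.coe_injective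
    fun n : ℕ => (2⁻¹ : ℝ≥0∞) ^ n).trans ?_
  rw [ENNReal.tsum_geometric, ENNReal.one_sub_inv_two, inv_inv]

theorem tsum_weight_le : ∑' n : ℕ+, weight d n ≤ 2 := by
  refine le_trans (ENNReal.tsum_le_tsum fun n => ?_) tsum_two_inv_pow_le
  rw [← weight_mul_volume_cube (d := d)]
  exact le_mul_of_one_le_right (zero_le) (one_le_volume_cube n)

/-! ### The space of Lebesgue classes inside an `L¹` space -/

/-- A finite measure equivalent to Lebesgue measure, for which convergence in measure is local
convergence in measure. -/
noncomputable def refMeasure (d : ℕ) : Measure (E d) :=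
  Measure.sum fun n : ℕ+ => weight d n • volume.restrict (cube d n)

theorem refMeasure_apply {S : Set (E d)} (hS : MeasurableSet S) :
    refMeasure d S = ∑' n : ℕ+, weight d n * volume (S ∩ cube d n) := by
  rw [refMeasure, Measure.sum_apply _ hS]
  simp [Measure.restrict_apply hS]

instance : IsFiniteMeasure (refMeasure d) := by
  refine ⟨?_⟩
  rw [refMeasure_apply MeasurableSet.univ]
  simp only [univ_inter, weight_mul_volume_cube]
  exact tsum_two_inv_pow_le.trans_lt (by simp)

theorem refMeasure_ac : refMeasure d ≪ volume := by
  refine Measure.absolutelyContinuous_sum_left fun n => ?_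
  exact Measure.restrict_le_self.absolutelyContinuous.smul_left _

theorem ae_eq_of_refMeasure {S T : Set (E d)} (hS : MeasurableSet S) (hT : MeasurableSet T)
    (h : refMeasure d (symmDiff S T) = 0) : S =ᵐ[volume] T := by
  rw [refMeasure_apply (hS.symmDiff hT), ENNReal.tsum_eq_zero] at h
  rw [← measure_symmDiff_eq_zero_iff, ← inter_univ (symmDiff S T), ← iUnion_cube, inter_iUnion,
    measure_iUnion_null_iff]
  intro n
  exact (mul_eq_zero.1 (h n)).resolve_left (weight_ne_zero n)

theorem memLp_indicator {S : Set (E d)} (hS : NullMeasurableSet S volume) :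
    MemLp (S.indicator (1 : E d → ℝ)) 1 (refMeasure d) := by
  have hS' : NullMeasurableSet S (refMeasure d) := hS.mono_ac refMeasure_ac
  refine MemLp.of_bound (aestronglyMeasurable_const.indicator₀ hS') 1 (ae_of_all _ fun x => ?_)
  by_cases hx : x ∈ S <;> simp [hx]

/-- The indicator function of a Lebesgue class, as an integrable function. -/
noncomputable def toL1 (d : ℕ) : M d → Lp ℝ 1 (refMeasure d) :=
  Quotient.lift (s := aeSetoid d) (fun A => (memLp_indicator A.2).toLp _)
    (fun A B (h : (A : Set (E d)) =ᵐ[volume] (B : Set (E d))) =>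
      (MemLp.toLp_eq_toLp_iff _ _).2
        (refMeasure_ac.ae_le (indicator_ae_eq_of_ae_eq_set (f := (1 : E d → ℝ)) h)))

theorem toL1_mk {S : Set (E d)} (hS : NullMeasurableSet S volume) :
    toL1 d (M.mk S hS) = (memLp_indicator hS).toLp _ := rfl

theorem edist_toL1_mk {S T : Set (E d)} (hS : MeasurableSet S) (hT : MeasurableSet T) :
    edist (toL1 d (M.mk S hS.nullMeasurableSet)) (toL1 d (M.mk T hT.nullMeasurableSet)) =
      refMeasure d (symmDiff S T) := by
  rw [toL1_mk, toL1_mk, Lp.edist_toLp_toLp, eLpNorm_one_eq_lintegral_enorm,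
    ← lintegral_indicator_one (hS.symmDiff hT)]
  congr 1 with x
  by_cases h1 : x ∈ S <;> by_cases h2 : x ∈ T <;> simp [h1, h2, mem_symmDiff]

theorem volume_inter_cube_le (n : ℕ+) {S : Set (E d)} (hS : MeasurableSet S) :
    weight d n * volume (S ∩ cube d n) ≤ refMeasure d S := by
  rw [refMeasure_apply hS]
  exact ENNReal.le_tsum n

theorem refMeasure_inter_cube_le (n : ℕ+) {S : Set (E d)} (hS : MeasurableSet S) :
    refMeasure d (S ∩ cube d n) ≤ 2 * volume (S ∩ cube d n) := by
  rw [refMeasure_apply (hS.inter (measurableSet_cube n))]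
  calc _ ≤ ∑' m : ℕ+, weight d m * volume (S ∩ cube d n) :=
        ENNReal.tsum_le_tsum fun m => mul_le_mul' le_rfl (measure_mono inter_subset_left)
    _ = (∑' m : ℕ+, weight d m) * volume (S ∩ cube d n) := ENNReal.tsum_mul_right
    _ ≤ _ := by gcongr; exact tsum_weight_le

theorem exists_refMeasure_compl_cube_lt {ε : ℝ≥0∞} (hε : 0 < ε) :
    ∃ n : ℕ+, refMeasure d (cube d n)ᶜ < ε := by
  have h := tendsto_measure_iInter_atTop (μ := refMeasure d) (s := fun n : ℕ+ => (cube d n)ᶜ)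
    (fun n => (measurableSet_cube n).compl.nullMeasurableSet)
    (fun n m hnm => compl_subset_compl.2 (cube_mono hnm)) ⟨1, measure_ne_top _ _⟩
  rw [← compl_iUnion, iUnion_cube, compl_univ, measure_empty] at h
  exact (h.eventually_lt_const hε).exists

/-- Two sets that agree up to small volume on a large cube are close. -/
theorem edist_toL1_le {S T : Set (E d)} (hS : MeasurableSet S) (hT : MeasurableSet T) (n : ℕ+) :
    edist (toL1 d (M.mk S hS.nullMeasurableSet)) (toL1 d (M.mk T hT.nullMeasurableSet)) ≤
      2 * volume (symmDiff S T ∩ cube d n) + refMeasure d (cube d n)ᶜ := by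
  rw [edist_toL1_mk hS hT]
  calc refMeasure d (symmDiff S T)
      ≤ refMeasure d (symmDiff S T ∩ cube d n ∪ (cube d n)ᶜ) := by
        refine measure_mono fun x hx => ?_
        by_cases hn : x ∈ cube d n
        · exact Or.inl ⟨hx, hn⟩
        · exact Or.inr hn
    _ ≤ _ := (measure_union_le _ _).trans
        (add_le_add_left (refMeasure_inter_cube_le n (hS.symmDiff hT)) _)

theorem isInducing_toL1 : Topology.IsInducing (toL1 d) := by
  rw [Topology.isInducing_iff_nhds]
  intro A
  refine le_antisymm ?_ ?_
  · rw [← Filter.tendsto_iff_comap, EMetric.tendsto_nhds]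
    intro ε hε
    obtain ⟨n, hn⟩ := exists_refMeasure_compl_cube_lt (d := d) (ENNReal.half_pos hε.ne')
    have h4 : (0 : ℝ≥0∞) < ε / 2 / 2 := ENNReal.half_pos (ENNReal.half_pos hε.ne').ne'
    filter_upwards [eventually_localDist_lt A (isWindow_cube d n).2.1 (isWindow_cube d n).1 h4]
      with B hB
    obtain ⟨S, hS, rfl⟩ := A.exists_rep
    obtain ⟨T, hT, rfl⟩ := B.exists_rep
    rw [localDist_mk] at hB
    rw [edist_comm]
    calc _ ≤ _ := edist_toL1_le hS hT n
      _ < ε / 2 + ε / 2 := by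
          refine ENNReal.add_lt_add ?_ hn
          rw [mul_comm]
          exact (ENNReal.lt_div_iff_mul_lt (by simp) (by simp)).1 hB
      _ = ε := ENNReal.add_halves ε
  · rw [TopologicalSpace.nhds_generateFrom]
    refine le_iInf₂ fun V hV => ?_
    obtain ⟨hAV, A', U, ε, -, hUb, -, rfl⟩ := hV
    rw [Filter.le_principal_iff]
    obtain ⟨n, hn⟩ := exists_subset_cube hUb
    have hpos : 0 < weight d n * (ε - localDist U A' A) :=
      ENNReal.mul_pos (weight_ne_zero n) (tsub_pos_of_lt hAV).ne'
    refine Filter.mem_comap.2 ⟨_, Metric.eball_mem_nhds _ hpos, ?_⟩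
    intro B hB
    rw [mem_preimage, Metric.mem_eball, edist_comm] at hB
    obtain ⟨S, hS, rfl⟩ := A.exists_rep
    obtain ⟨T, hT, rfl⟩ := B.exists_rep
    obtain ⟨R, hR, rfl⟩ := A'.exists_rep
    simp only [mem_ofPred_eq, localDist_mk] at hAV hB ⊢
    rw [edist_toL1_mk hS hT] at hB
    have h1 : volume (symmDiff S T ∩ U) < ε - volume (symmDiff R S ∩ U) := by
      refine (measure_mono (inter_subset_inter_right _ hn)).trans_lt ?_
      have h2 := (volume_inter_cube_le n (hS.symmDiff hT)).trans_lt hB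
      exact lt_of_mul_lt_mul_left' h2
    calc volume (symmDiff R T ∩ U) ≤ volume (symmDiff R S ∩ U ∪ symmDiff S T ∩ U) := by
          refine measure_mono fun x hx => ?_
          simp only [mem_symmDiff, mem_inter_iff, mem_union] at hx ⊢
          tauto
      _ ≤ volume (symmDiff R S ∩ U) + volume (symmDiff S T ∩ U) := measure_union_le _ _
      _ < ε := by
          rw [add_comm]
          exact lt_tsub_iff_right.1 h1

theorem injective_toL1 : Function.Injective (toL1 d) := by
  intro A B h
  obtain ⟨S, hS, rfl⟩ := A.exists_rep
  obtain ⟨T, hT, rfl⟩ := B.exists_rep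
  have h0 := edist_toL1_mk hS hT
  rw [h, edist_self] at h0
  exact Quotient.sound (s := aeSetoid d) (ae_eq_of_refMeasure hS hT h0.symm)

instance : T2Space (M d) :=
  Topology.IsEmbedding.t2Space (f := toL1 d) ⟨isInducing_toL1, injective_toL1⟩

instance : SecondCountableTopology (M d) := by
  have : Fact ((1 : ℝ≥0∞) ≠ ∞) := ⟨ENNReal.one_ne_top⟩
  exact (isInducing_toL1 (d := d)).secondCountableTopology

/-- An `L¹` limit of indicator functions is an indicator function. -/
theorem isClosed_range_toL1 : IsClosed (range (toL1 d)) := by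
  refine isClosed_of_closure_subset fun f hf => ?_
  obtain ⟨x, hx, hlim⟩ := mem_closure_iff_seq_limit.1 hf
  obtain ⟨ns, -, hns⟩ := (tendstoInMeasure_of_tendsto_Lp hlim).exists_seq_tendsto_ae
  have hT : MeasurableSet {z | f z = 1} :=
    (Lp.stronglyMeasurable f).measurable (measurableSet_singleton 1)
  have h01 : ∀ n, ∀ᵐ z ∂(refMeasure d), x n z = 0 ∨ x n z = 1 := by
    intro n
    obtain ⟨A, hA⟩ := hx n
    obtain ⟨S, hS, rfl⟩ := A.exists_rep
    rw [← hA, toL1_mk]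
    filter_upwards [(memLp_indicator hS.nullMeasurableSet).coeFn_toLp] with z hz
    rw [hz]
    by_cases h : z ∈ S <;> simp [h]
  refine ⟨M.mk _ hT.nullMeasurableSet, ?_⟩
  rw [toL1_mk]
  refine Lp.ext ?_
  filter_upwards [(memLp_indicator hT.nullMeasurableSet).coeFn_toLp, hns, ae_all_iff.2 h01]
    with z h1 h2 h3
  rw [h1]
  have hcl : f z ∈ ({0, 1} : Set ℝ) :=
    (Set.toFinite ({0, 1} : Set ℝ)).isClosed.mem_of_tendsto h2
      (Filter.Eventually.of_forall fun i => h3 (ns i))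
  rcases hcl with h | h
  · simp [h]
  · have h' : f z = 1 := h
    simp [h']

/-- A closed set of Lebesgue classes that is totally bounded for the distance of convergence in
measure is compact. -/
theorem isCompact_of_forall_net {K : Set (M d)} (hK : IsClosed K)
    (h : ∀ ε : ℝ≥0∞, 0 < ε → ∃ t : Set (M d), t.Finite ∧
      ∀ A ∈ K, ∃ B ∈ t, edist (toL1 d A) (toL1 d B) < ε) : IsCompact K := by
  rw [(isInducing_toL1 (d := d)).isCompact_iff, isCompact_iff_totallyBounded_isComplete]
  have hce : Topology.IsClosedEmbedding (toL1 d) :=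
    ⟨⟨isInducing_toL1, injective_toL1⟩, isClosed_range_toL1⟩
  refine ⟨EMetric.totallyBounded_iff.2 fun ε hε => ?_, (hce.isClosedMap K hK).isComplete⟩
  obtain ⟨t, ht, hA⟩ := h ε hε
  refine ⟨toL1 d '' t, ht.image _, ?_⟩
  rintro _ ⟨A, hAK, rfl⟩
  obtain ⟨B, hB, hAB⟩ := hA A hAK
  exact mem_iUnion₂.2 ⟨_, mem_image_of_mem _ hB, hAB⟩

/-! ### Sampling a set on a grid -/

/-- The corner of the cell of the grid `hℤ^d` containing `x`. -/
noncomputable def gridPoint (h : ℝ) (x : E d) : E d := WithLp.toLp 2 fun i => h * ⌊x i / h⌋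

/-- The half-open cell `[0, h)^d`. -/
def cell (d : ℕ) (h : ℝ) : Set (E d) := {x | ∀ i, x i ∈ Ico 0 h}

/-- The union of the grid cells whose corner, shifted by `τ`, lies in `S`. -/
def pixel (h : ℝ) (S : Set (E d)) (τ : E d) : Set (E d) := {x | gridPoint h x + τ ∈ S}

@[simp] theorem gridPoint_apply (h : ℝ) (x : E d) (i : Fin d) :
    gridPoint h x i = h * ⌊x i / h⌋ := rfl

theorem measurable_gridPoint (h : ℝ) : Measurable (gridPoint h : E d → E d) := by
  refine (WithLp.measurable_toLp 2 _).comp (measurable_pi_lambda _ fun i => ?_)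
  have h1 : Measurable fun x : E d => x i / h := by fun_prop
  have h2 : Measurable fun x : E d => ((⌊x i / h⌋ : ℤ) : ℝ) :=
    (measurable_from_top (f := fun z : ℤ => (z : ℝ))).comp (Int.measurable_floor.comp h1)
  exact h2.const_mul h

theorem measurableSet_cell (h : ℝ) : MeasurableSet (cell d h) := by
  have : cell d h = ⋂ i, (fun x : E d => x i) ⁻¹' Ico 0 h := by
    ext x; simp [cell]
  rw [this]
  exact MeasurableSet.iInter fun i => measurableSet_Ico.preimage (by fun_prop)

theorem measurableSet_pixel (h : ℝ) {S : Set (E d)} (hS : MeasurableSet S) (τ : E d) :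
    MeasurableSet (pixel h S τ) :=
  hS.preimage ((measurable_gridPoint h).add_const τ)

theorem gridPoint_eq_iff {h : ℝ} (hh : 0 < h) (x y : E d) :
    gridPoint h x = gridPoint h y ↔ x - gridPoint h y ∈ cell d h := by
  have key : ∀ i, h * (⌊x i / h⌋ : ℝ) = h * (⌊y i / h⌋ : ℝ) ↔
      x i - h * ⌊y i / h⌋ ∈ Ico 0 h := by
    intro i
    rw [mul_right_inj' hh.ne', Int.cast_inj, Int.floor_eq_iff, le_div_iff₀ hh, div_lt_iff₀ hh,
      mem_Ico]
    constructor <;> rintro ⟨h1, h2⟩ <;> constructor <;> linarith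
  constructor
  · intro hxy i
    have := (key i).1 (by simpa using congrArg (fun v : E d => v i) hxy)
    simpa using this
  · intro hxy
    ext i
    have := hxy i
    simp only [PiLp.sub_apply, gridPoint_apply] at this ⊢
    exact (key i).2 this

theorem sub_gridPoint_mem_cell {h : ℝ} (hh : 0 < h) (x : E d) : x - gridPoint h x ∈ cell d h :=
  (gridPoint_eq_iff hh x x).1 rfl

theorem volume_box (c : Fin d → ℝ) :
    volume {x : E d | ∀ i, x i ∈ Ico 0 (c i)} = ∏ i, ENNReal.ofReal (c i) := by
  have h : {x : E d | ∀ i, x i ∈ Ico 0 (c i)} =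
      WithLp.ofLp ⁻¹' (univ.pi fun i : Fin d => Ico 0 (c i)) := by
    ext x
    simp
  rw [h, (PiLp.volume_preserving_ofLp (Fin d)).measure_preimage
    (MeasurableSet.univ_pi fun _ => measurableSet_Ico).nullMeasurableSet, Real.volume_pi_Ico]
  simp

theorem volume_cell {h : ℝ} (hh : 0 < h) : volume (cell d h) = ENNReal.ofReal (h ^ d) := by
  rw [cell, volume_box fun _ => h]
  simp [ENNReal.ofReal_pow hh.le]

theorem volume_cell_ne_zero {h : ℝ} (hh : 0 < h) : volume (cell d h) ≠ 0 := by
  rw [volume_cell hh]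
  exact (ENNReal.ofReal_pos.2 (by positivity)).ne'

theorem volume_cell_ne_top {h : ℝ} (hh : 0 < h) : volume (cell d h) ≠ ∞ := by
  rw [volume_cell hh]
  exact ENNReal.ofReal_ne_top

theorem volume_gridPoint_eq {h : ℝ} (hh : 0 < h) (y : E d) :
    volume {x | gridPoint h x = gridPoint h y} = volume (cell d h) := by
  simp only [gridPoint_eq_iff hh, sub_eq_add_neg]
  exact measure_preimage_add_right volume (-gridPoint h y) (cell d h)

/-- The slab of width `ε` along a face of a grid cell takes up the proportion `ε / h` of it. -/
theorem volume_slab_le {h : ℝ} (hh : 0 < h) (ε : ℝ) (j : Fin d) (y : E d) :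
    ENNReal.ofReal h * volume {x | x j < gridPoint h x j + ε ∧ gridPoint h x = gridPoint h y} ≤
      ENNReal.ofReal ε * volume (cell d h) := by
  have hsub : {x | x j < gridPoint h x j + ε ∧ gridPoint h x = gridPoint h y} ⊆
      (fun x => x + -gridPoint h y) ⁻¹'
        {x : E d | ∀ i, x i ∈ Ico 0 (Function.update (fun _ => h) j ε i)} := by
    rintro x ⟨h1, h2⟩ i
    have h3 := (gridPoint_eq_iff hh x y).1 h2 i
    rw [h2] at h1
    by_cases hij : i = j
    · subst hij
      simp only [PiLp.sub_apply, PiLp.add_apply, PiLp.neg_apply, Function.update_self] at h3 ⊢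
      exact ⟨by linarith [h3.1], by linarith⟩
    · rw [Function.update_of_ne hij]
      simpa [sub_eq_add_neg] using h3
  calc _ ≤ ENNReal.ofReal h * ∏ i, ENNReal.ofReal (Function.update (fun _ => h) j ε i) := by
        rw [← volume_box]
        exact mul_le_mul' le_rfl
          ((measure_mono hsub).trans_eq (measure_preimage_add_right volume _ _))
    _ = ENNReal.ofReal ε * volume (cell d h) := by
        rw [cell, volume_box fun _ => h, ← Finset.mul_prod_erase _ _ (Finset.mem_univ j),
          ← Finset.mul_prod_erase _ (fun i => ENNReal.ofReal h) (Finset.mem_univ j),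
          Function.update_self, mul_left_comm]
        congr 2
        refine Finset.prod_congr rfl fun i hi => ?_
        rw [Function.update_of_ne (Finset.ne_of_mem_erase hi)]

/-- Averaging over the sampling offset `τ` amounts to averaging over the cell of `x`. -/
theorem lintegral_cell_gridPoint {h : ℝ} (hh : 0 < h) {U : Set (E d)}
    {F : E d → E d → ℝ≥0∞} (hF : Measurable (Function.uncurry F)) :
    ∫⁻ τ in cell d h, ∫⁻ x in U, F x (gridPoint h x + τ) =
      ∫⁻ x in U, ∫⁻ y in {y | gridPoint h y = gridPoint h x}, F x y := by
  have hg := measurable_gridPoint (d := d) h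
  rw [lintegral_lintegral_swap]
  · refine lintegral_congr fun x => ?_
    have hm : MeasurableSet {y | gridPoint h y = gridPoint h x} :=
      hg (measurableSet_singleton _)
    rw [← lintegral_indicator (measurableSet_cell h), ← lintegral_indicator hm,
      ← lintegral_add_left_eq_self _ (-gridPoint h x)]
    refine lintegral_congr fun y => ?_
    have : -gridPoint h x + y ∈ cell d h ↔ gridPoint h y = gridPoint h x := by
      rw [gridPoint_eq_iff hh, sub_eq_neg_add]
    by_cases hy : gridPoint h y = gridPoint h x
    · rw [indicator_of_mem (this.2 hy), indicator_of_mem (show y ∈ _ from hy), add_neg_cancel_left]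
    · rw [indicator_of_notMem (fun hc => hy (this.1 hc)), indicator_of_notMem (by simpa using hy)]
  · refine Measurable.aemeasurable ?_
    exact hF.comp (measurable_snd.prodMk ((hg.comp measurable_snd).add measurable_fst))

/-- The same, for a function of the sampled point only, integrated over the sampled point. -/
theorem lintegral_cell_gridPoint' {h : ℝ} (hh : 0 < h) {U : Set (E d)} {F : E d → ℝ≥0∞}
    (hF : Measurable F) :
    ∫⁻ τ in cell d h, ∫⁻ x in U, F (gridPoint h x + τ) =
      ∫⁻ y, F y * volume {x | x ∈ U ∧ gridPoint h x = gridPoint h y} := by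
  have hg := measurable_gridPoint (d := d) h
  rw [lintegral_cell_gridPoint hh (F := fun _ y => F y) (hF.comp measurable_snd)]
  have hm : ∀ x, MeasurableSet {y | gridPoint h y = gridPoint h x} := fun x =>
    hg (measurableSet_singleton _)
  have hm2 : MeasurableSet {p : E d × E d | gridPoint h p.2 = gridPoint h p.1} :=
    measurableSet_eq_fun (hg.comp measurable_snd) (hg.comp measurable_fst)
  calc ∫⁻ x in U, ∫⁻ y in {y | gridPoint h y = gridPoint h x}, F y
      = ∫⁻ x in U, ∫⁻ y, {p : E d × E d | gridPoint h p.2 = gridPoint h p.1}.indicator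
          (fun p => F p.2) (x, y) := by
        refine lintegral_congr fun x => ?_
        rw [← lintegral_indicator (hm x)]
        rfl
    _ = ∫⁻ y, ∫⁻ x in U, {p : E d × E d | gridPoint h p.2 = gridPoint h p.1}.indicator
          (fun p => F p.2) (x, y) := by
        rw [lintegral_lintegral_swap]
        exact ((hF.comp measurable_snd).indicator hm2).aemeasurable
    _ = _ := by
        refine lintegral_congr fun y => ?_
        have : ∀ x, {p : E d × E d | gridPoint h p.2 = gridPoint h p.1}.indicator
            (fun p => F p.2) (x, y) =
            {x | gridPoint h x = gridPoint h y}.indicator (fun _ => F y) x := by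
          intro x
          by_cases hxy : gridPoint h x = gridPoint h y
          · simp [hxy]
          · simp [hxy, Ne.symm hxy]
        simp only [this]
        rw [lintegral_indicator (hm y), lintegral_const, Measure.restrict_apply MeasurableSet.univ,
          univ_inter, Measure.restrict_apply (hm y), inter_comm]
        rfl

theorem abs_sub_lt_of_gridPoint_eq {h : ℝ} (hh : 0 < h) {x y : E d}
    (hxy : gridPoint h x = gridPoint h y) (i : Fin d) : |x i - y i| < h := by
  have h1 := (gridPoint_eq_iff hh x y).1 hxy i
  have h2 := sub_gridPoint_mem_cell hh y i
  simp only [PiLp.sub_apply, mem_Ico] at h1 h2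
  rw [abs_lt]
  constructor <;> linarith [h1.1, h1.2, h2.1, h2.2]

theorem dist_le_of_gridPoint_eq {h : ℝ} (hh : 0 < h) {x y : E d}
    (hxy : gridPoint h x = gridPoint h y) : dist x y ≤ (d + 1) * h := by
  rw [EuclideanSpace.dist_eq]
  refine Real.sqrt_le_iff.2 ⟨by positivity, ?_⟩
  calc ∑ i, dist (x i) (y i) ^ 2 ≤ ∑ _i : Fin d, h ^ 2 := by
        refine Finset.sum_le_sum fun i _ => ?_
        rw [Real.dist_eq]
        exact pow_le_pow_left₀ (abs_nonneg _) (abs_sub_lt_of_gridPoint_eq hh hxy i).le 2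
    _ = d * h ^ 2 := by simp
    _ ≤ ((d + 1) * h) ^ 2 := by
        rw [mul_pow]
        gcongr
        nlinarith [(Nat.cast_nonneg d : (0 : ℝ) ≤ d)]

/-- Shifting by at most one grid step moves to the same cell or to the previous one. -/
theorem gridPoint_sub_smul_e {h ε : ℝ} (hh : 0 < h) (hε0 : 0 < ε) (hε : ε ≤ h) (j : Fin d)
    (x : E d) : gridPoint h (x - ε • e j) = gridPoint h x ∨
      (gridPoint h (x - ε • e j) = gridPoint h x - h • e j ∧ x j < gridPoint h x j + ε) := by
  have hx := sub_gridPoint_mem_cell hh x j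
  simp only [PiLp.sub_apply, gridPoint_apply, mem_Ico] at hx
  by_cases hlt : x j < gridPoint h x j + ε
  · right
    refine ⟨?_, hlt⟩
    ext i
    rw [gridPoint_apply] at hlt
    by_cases hij : i = j
    · subst hij
      have : ⌊(x i - ε) / h⌋ = ⌊x i / h⌋ - 1 := by
        rw [Int.floor_eq_iff, le_div_iff₀ hh, div_lt_iff₀ hh]
        push_cast
        constructor <;> nlinarith [hx.1, hx.2]
      simp only [gridPoint_apply, PiLp.sub_apply, PiLp.smul_apply, PiLp.single_apply,
        if_true, smul_eq_mul, mul_one, this]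
      push_cast
      ring
    · simp [hij]
  · left
    rw [gridPoint_apply] at hlt
    ext i
    by_cases hij : i = j
    · subst hij
      have : ⌊(x i - ε) / h⌋ = ⌊x i / h⌋ := by
        rw [Int.floor_eq_iff, le_div_iff₀ hh, div_lt_iff₀ hh]
        constructor <;> nlinarith [hx.1, hx.2]
      simp only [gridPoint_apply, PiLp.sub_apply, PiLp.smul_apply, PiLp.single_apply,
        if_true, smul_eq_mul, mul_one, this]
    · simp [hij]

theorem gridPoint_sub_of_grid {h : ℝ} (hh : 0 < h) {y : E d} (hy : ∀ i, ∃ k : ℤ, y i = h * k)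
    (x : E d) : gridPoint h (x - y) = gridPoint h x - y := by
  ext i
  obtain ⟨k, hk⟩ := hy i
  have : ⌊(x i - y i) / h⌋ = ⌊x i / h⌋ - k := by
    rw [hk, sub_div, mul_div_cancel_left₀ _ hh.ne', Int.floor_sub_intCast]
  simp only [gridPoint_apply, PiLp.sub_apply, this]
  rw [hk]
  push_cast
  ring

/-! ### Covariograms and jump volumes of sampled sets -/

theorem measurable_pixel_prod (h : ℝ) {S : Set (E d)} (hS : MeasurableSet S) :
    MeasurableSet {p : E d × E d | p.2 ∈ pixel h S p.1} :=
  hS.preimage (((measurable_gridPoint h).comp measurable_snd).add measurable_fst)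

theorem add_mem_cube {n : ℕ+} {x v : E d} (hx : x ∈ cube d n) (hv : ∀ i, |v i| ≤ 1) :
    x + v ∈ cube d (n + 1) := by
  intro i
  have h1 := hx i
  have h2 := abs_le.1 (hv i)
  simp only [PiLp.add_apply, PNat.add_coe, PNat.val_ofNat, Nat.cast_add, Nat.cast_one]
  exact ⟨by linarith [h1.1], by linarith [h1.2]⟩

theorem sub_mem_cube {n : ℕ+} {x v : E d} (hx : x ∈ cube d n) (hv : ∀ i, |v i| ≤ 1) :
    x - v ∈ cube d (n + 1) := by
  rw [sub_eq_add_neg]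
  exact add_mem_cube hx fun i => by simpa using hv i

theorem abs_smul_e_le {c : ℝ} (hc : |c| ≤ 1) (j i : Fin d) : |(c • e j : E d) i| ≤ 1 := by
  by_cases hij : i = j
  · subst hij
    simpa using hc
  · simp [hij]

/-- Averaged over the sampling offset, the jump volume of a sampled set for a step `ε` shorter than
the grid spacing `h` is controlled by that of the original set for the step `h`: a jump of the
sampled set can occur only in slabs along the faces of the cells, which have density `ε / h`. -/
theorem lintegral_jumpVol_pixel_le {S : Set (E d)} (hS : MeasurableSet S) {h ε : ℝ} (hh : 0 < h)
    (hh1 : h ≤ 1) (hε0 : 0 < ε) (hε : ε ≤ h) (j : Fin d) (n : ℕ+) :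
    ENNReal.ofReal h * ∫⁻ τ in cell d h, jumpVol (pixel h S τ) (ε • e j) (cube d n) ≤
      ENNReal.ofReal ε * volume (cell d h) * jumpVol S (h • e j) (cube d (n + 2)) := by
  have hg := measurable_gridPoint (d := d) h
  set J : Set (E d) := {x | ¬(x ∈ S ↔ x - h • e j ∈ S)} with hJ
  have hJm : MeasurableSet J := by
    have : J = {x | x ∈ univ ∧ x - h • e j ∈ univ ∧ ¬(x ∈ S ↔ x - h • e j ∈ S)} := by
      simp only [hJ, mem_univ, true_and]
    rw [this]
    exact measurableSet_jump hS MeasurableSet.univ (h • e j)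
  set U : Set (E d) := {x | x ∈ cube d n ∧ x j < gridPoint h x j + ε} with hU
  have hUm : MeasurableSet U := by
    have hj : Measurable fun x : E d => x j := by fun_prop
    exact (measurableSet_cube n).inter (measurableSet_lt hj ((hj.comp hg).add_const ε))
  have h1 : ∀ τ, jumpVol (pixel h S τ) (ε • e j) (cube d n) ≤
      ∫⁻ x in U, J.indicator 1 (gridPoint h x + τ) := by
    intro τ
    have : ∫⁻ x in U, J.indicator (1 : E d → ℝ≥0∞) (gridPoint h x + τ) =
        volume ({x | gridPoint h x + τ ∈ J} ∩ U) := by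
      have hm : MeasurableSet {x | gridPoint h x + τ ∈ J} := hJm.preimage (hg.add_const τ)
      rw [← Measure.restrict_apply hm, ← lintegral_indicator_one hm]
      rfl
    rw [this]
    refine measure_mono fun x hx => ?_
    obtain ⟨hx1, hx2, hx3⟩ := hx
    simp only [pixel, mem_ofPred_eq] at hx3
    rcases gridPoint_sub_smul_e hh hε0 hε j x with h0 | ⟨h0, h2⟩
    · rw [h0] at hx3
      exact absurd Iff.rfl hx3
    · rw [h0, sub_add_eq_add_sub] at hx3
      exact ⟨hx3, hx1, h2⟩
  calc ENNReal.ofReal h * ∫⁻ τ in cell d h, jumpVol (pixel h S τ) (ε • e j) (cube d n)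
      ≤ ENNReal.ofReal h *
          ∫⁻ τ in cell d h, ∫⁻ x in U, J.indicator 1 (gridPoint h x + τ) := by
        gcongr with τ
        exact h1 τ
    _ = ENNReal.ofReal h * ∫⁻ y, J.indicator 1 y *
          volume {x | x ∈ U ∧ gridPoint h x = gridPoint h y} := by
        rw [lintegral_cell_gridPoint' hh (measurable_one.indicator hJm)]
    _ ≤ ENNReal.ofReal h * ∫⁻ y, {y | y ∈ cube d (n + 2) ∧ y - h • e j ∈ cube d (n + 2) ∧
          ¬(y ∈ S ↔ y - h • e j ∈ S)}.indicator 1 y * (ENNReal.ofReal ε * volume (cell d h) /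
            ENNReal.ofReal h) := by
        refine mul_le_mul' le_rfl (lintegral_mono fun y => ?_)
        beta_reduce
        by_cases hy : y ∈ J
        swap
        · simp [hy]
        by_cases hy2 : y ∈ cube d (n + 1)
        · have hy3 : y ∈ cube d (n + 2) := cube_mono (by
            rw [show (2 : ℕ+) = 1 + 1 from rfl, ← add_assoc]
            exact (PNat.lt_add_right _ _).le) hy2
          have hy4 : y - h • e j ∈ cube d (n + 2) := by
            rw [show (2 : ℕ+) = 1 + 1 from rfl, ← add_assoc]
            exact sub_mem_cube hy2 (abs_smul_e_le (by rwa [abs_of_pos hh]) j)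
          have hyR : y ∈ {y | y ∈ cube d (n + 2) ∧ y - h • e j ∈ cube d (n + 2) ∧
              ¬(y ∈ S ↔ y - h • e j ∈ S)} := ⟨hy3, hy4, hy⟩
          rw [indicator_of_mem hy, indicator_of_mem hyR]
          simp only [Pi.one_apply, one_mul]
          rw [ENNReal.le_div_iff_mul_le (by simp [hh]) (by simp), mul_comm]
          refine le_trans (mul_le_mul' le_rfl (measure_mono ?_)) (volume_slab_le hh ε j y)
          exact fun x hx => ⟨hx.1.2, hx.2⟩
        · have : {x | x ∈ U ∧ gridPoint h x = gridPoint h y} = ∅ := by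
            refine eq_empty_of_forall_notMem fun x hx => hy2 ?_
            have : y = x + (y - x) := by abel
            rw [this]
            refine add_mem_cube hx.1.1 fun i => ?_
            exact ((abs_sub_lt_of_gridPoint_eq hh hx.2.symm i).le.trans hh1)
          simp [this]
    _ = _ := by
        have hm := measurableSet_jump hS (measurableSet_cube (n + 2)) (h • e j)
        rw [lintegral_mul_const _ (measurable_one.indicator hm), lintegral_indicator_one hm,
          mul_comm (volume _), ← mul_assoc, ENNReal.mul_div_cancel (by simp [hh]) (by simp)]
        rfl

/-- A grid cell that meets both a set and its complement lies near the boundary of the set. -/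
theorem mem_cthickening_of_gridPoint_eq {h : ℝ} (hh : 0 < h) {W : Set (E d)} (hW : IsOpen W)
    {x y : E d} (hxy : gridPoint h x = gridPoint h y) (hx : x ∈ W) (hy : y ∉ W) :
    x ∈ Metric.cthickening ((d + 1) * h) (frontier W) ∧
      y ∈ Metric.cthickening ((d + 1) * h) (frontier W) := by
  have hfr : (segment ℝ x y ∩ frontier W).Nonempty := by
    by_contra hne
    have hcov : segment ℝ x y ⊆ W ∪ (closure W)ᶜ := by
      intro z hz
      by_contra hz2
      simp only [mem_union, mem_compl_iff, not_or, not_not] at hz2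
      exact hne ⟨z, hz, by rw [frontier, hW.interior_eq]; exact ⟨hz2.2, hz2.1⟩⟩
    have hy2 : y ∉ closure W := by
      rcases hcov (right_mem_segment ℝ x y) with h1 | h1
      · exact absurd h1 hy
      · exact h1
    obtain ⟨z, -, hz1, hz2⟩ := (convex_segment x y).isPreconnected W (closure W)ᶜ hW
      isClosed_closure.isOpen_compl hcov ⟨x, left_mem_segment ℝ x y, hx⟩
      ⟨y, right_mem_segment ℝ x y, hy2⟩
    exact hz2 (subset_closure hz1)
  obtain ⟨z, hz, hzW⟩ := hfr
  have hd := dist_le_of_gridPoint_eq hh hxy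
  have hd2 := dist_add_dist_of_mem_segment hz
  constructor
  · exact Metric.mem_cthickening_of_dist_le x z _ _ hzW (by linarith [dist_nonneg (x := z) (y := y)])
  · refine Metric.mem_cthickening_of_dist_le y z _ _ hzW ?_
    rw [dist_comm]
    linarith [dist_nonneg (x := x) (y := z)]

/-- The covariogram at a grid vector `y` is preserved by sampling, on average and up to the cells
that meet the boundary of the window. -/
theorem lintegral_covariogram_pixel {S : Set (E d)} (hS : MeasurableSet S) {h : ℝ} (hh : 0 < h)
    {y : E d} (hy : ∀ i, ∃ k : ℤ, y i = h * k) (W : Window d) :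
    ∫⁻ τ in cell d h, volume {x | x ∈ pixel h S τ ∧ x - y ∈ pixel h S τ ∧ x ∈ W.1} ≤
        volume (cell d h) * (volume {x | x ∈ S ∧ x - y ∈ S ∧ x ∈ W.1} +
          volume (Metric.cthickening ((d + 1) * h) (frontier W.1))) ∧
      volume (cell d h) * volume {x | x ∈ S ∧ x - y ∈ S ∧ x ∈ W.1} ≤
        (∫⁻ τ in cell d h, volume {x | x ∈ pixel h S τ ∧ x - y ∈ pixel h S τ ∧ x ∈ W.1}) +
          volume (cell d h) * volume (Metric.cthickening ((d + 1) * h) (frontier W.1)) := by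
  have hg := measurable_gridPoint (d := d) h
  set B := Metric.cthickening ((d + 1) * h) (frontier W.1) with hB
  have hBm : MeasurableSet B := Metric.isClosed_cthickening.measurableSet
  set T : Set (E d) := {x | x ∈ S ∧ x - y ∈ S} with hT
  have hTm : MeasurableSet T :=
    hS.inter (hS.preimage (by fun_prop : Measurable fun x : E d => x - y))
  have hWm := W.measurableSet
  have h1 : ∫⁻ τ in cell d h, volume {x | x ∈ pixel h S τ ∧ x - y ∈ pixel h S τ ∧ x ∈ W.1} =
      ∫⁻ z, T.indicator 1 z * volume {x | x ∈ W.1 ∧ gridPoint h x = gridPoint h z} := by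
    rw [← lintegral_cell_gridPoint' hh (measurable_one.indicator hTm)]
    refine lintegral_congr fun τ => ?_
    have hm : MeasurableSet {x | gridPoint h x + τ ∈ T} := hTm.preimage (hg.add_const τ)
    have : {x | x ∈ pixel h S τ ∧ x - y ∈ pixel h S τ ∧ x ∈ W.1} =
        {x | gridPoint h x + τ ∈ T} ∩ W.1 := by
      ext x
      simp only [pixel, mem_ofPred_eq, gridPoint_sub_of_grid hh hy, hT, mem_inter_iff,
        sub_add_eq_add_sub, and_assoc]
    rw [this, ← Measure.restrict_apply hm, ← lintegral_indicator_one hm]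
    rfl
  have h2 : volume {x | x ∈ S ∧ x - y ∈ S ∧ x ∈ W.1} = ∫⁻ z, (T ∩ W.1).indicator 1 z := by
    rw [lintegral_indicator_one (hTm.inter hWm)]
    congr 1
    ext x
    simp only [hT, mem_ofPred_eq, mem_inter_iff, and_assoc]
  have h3 : volume B = ∫⁻ z, B.indicator 1 z := (lintegral_indicator_one hBm).symm
  have hcell : ∀ z, volume {x | x ∈ W.1 ∧ gridPoint h x = gridPoint h z} ≤ volume (cell d h) :=
    fun z => (measure_mono fun x hx => hx.2).trans_eq (volume_gridPoint_eq hh z)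
  have hTW : Measurable fun z => (T ∩ W.1).indicator (1 : E d → ℝ≥0∞) z :=
    measurable_one.indicator (hTm.inter hWm)
  have hBi : Measurable fun z => B.indicator (1 : E d → ℝ≥0∞) z := measurable_one.indicator hBm
  rw [h1, h2, h3]
  constructor
  · rw [← lintegral_add_left hTW, ← lintegral_const_mul _ (f := fun z =>
      (T ∩ W.1).indicator (1 : E d → ℝ≥0∞) z + B.indicator (1 : E d → ℝ≥0∞) z) (hTW.add hBi)]
    refine lintegral_mono fun z => ?_
    by_cases hzT : z ∈ T
    swap
    · simp [hzT]
    rw [indicator_of_mem hzT, Pi.one_apply, one_mul]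
    by_cases hzW : z ∈ W.1
    · rw [indicator_of_mem (show z ∈ T ∩ W.1 from ⟨hzT, hzW⟩)]
      refine (hcell z).trans (le_mul_of_one_le_right zero_le ?_)
      simp
    · by_cases hzB : z ∈ B
      · rw [indicator_of_mem hzB]
        refine (hcell z).trans (le_mul_of_one_le_right zero_le ?_)
        simp
      · have : {x | x ∈ W.1 ∧ gridPoint h x = gridPoint h z} = ∅ := by
          refine eq_empty_of_forall_notMem fun x hx => hzB ?_
          exact (mem_cthickening_of_gridPoint_eq hh W.2.2.1 hx.2 hx.1 hzW).2
        simp [this]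
  · rw [← lintegral_const_mul _ hTW, ← lintegral_const_mul _ hBi,
      ← lintegral_add_right _ (hBi.const_mul _)]
    refine lintegral_mono fun z => ?_
    by_cases hz : z ∈ T ∩ W.1
    swap
    · simp [hz]
    rw [indicator_of_mem hz, indicator_of_mem hz.1, Pi.one_apply, mul_one, one_mul]
    by_cases hzB : z ∈ B
    · simp [hzB]
    · rw [← volume_gridPoint_eq hh z]
      refine le_add_right (measure_mono fun x hx => ⟨?_, hx⟩)
      by_contra hxW
      exact hzB (mem_cthickening_of_gridPoint_eq hh W.2.2.1 (Eq.symm hx) hz.2 hxW).1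

/-! ### Compactness of sets of bounded variation -/

/-- Translations move a set by a volume controlled by its variations along the coordinates. -/
theorem volume_translate_le {S : Set (E d)} (hS : MeasurableSet S) {n : ℕ+} {c : ℝ≥0∞}
    (hc : ∀ j, setVariation S (e j) (cube d (n + 2)) ≤ c) {h : ℝ} (hh1 : h ≤ 1)
    {s : E d} (hs : ∀ i, |s i| ≤ h) :
    volume {x | x ∈ cube d n ∧ ¬(x ∈ S ↔ x - s ∈ S)} ≤ d * (ENNReal.ofReal h * c) := by
  -- The translation is performed one coordinate at a time.
  have key : ∀ J : Finset (Fin d),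
      volume {x | x ∈ cube d n ∧ ¬(x ∈ S ↔ x - ∑ j ∈ J, s j • e j ∈ S)} ≤
        J.card * (ENNReal.ofReal h * c) := by
    intro J
    induction J using Finset.induction_on with
    | empty => simp
    | insert j J hj ih =>
      set v : E d := ∑ j ∈ J, s j • e j with hv
      have hvi : ∀ i, |v i| ≤ 1 := by
        intro i
        have : v i = if i ∈ J then s i else 0 := by
          simp [hv, Pi.single_apply]
        rw [this]
        split_ifs
        · exact (hs i).trans hh1
        · simp
      have hsub : {x | x ∈ cube d n ∧ ¬(x ∈ S ↔ x - ∑ j ∈ insert j J, s j • e j ∈ S)} ⊆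
          {x | x ∈ cube d n ∧ ¬(x ∈ S ↔ x - v ∈ S)} ∪ (fun x => x + -v) ⁻¹'
            {x | x ∈ cube d (n + 2) ∧ x - s j • e j ∈ cube d (n + 2) ∧
              ¬(x ∈ S ↔ x - s j • e j ∈ S)} := by
        rintro x ⟨hx1, hx2⟩
        rw [Finset.sum_insert hj, ← hv, sub_add_eq_sub_sub_swap] at hx2
        by_cases hxv : (x ∈ S ↔ x - v ∈ S)
        · right
          have hxc : x - v ∈ cube d (n + 1) := sub_mem_cube hx1 hvi
          have h2 : (n + 2 : ℕ+) = n + 1 + 1 := by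
            rw [add_assoc]
            rfl
          rw [mem_preimage, ← sub_eq_add_neg, h2]
          refine ⟨cube_mono (PNat.lt_add_right _ _).le hxc,
            sub_mem_cube hxc (abs_smul_e_le ((hs j).trans hh1) j), ?_⟩
          rwa [← hxv]
        · exact Or.inl ⟨hx1, hxv⟩
      have hW := isWindow_cube d (n + 2)
      have hj2 : jumpVol S (s j • e j) (cube d (n + 2)) ≤ ENNReal.ofReal h * c :=
        calc _ ≤ _ := jumpVol_le_setVariation hS hW.2.1 hW.1.measure_lt_top.ne (cube_convex d _) _
          _ ≤ _ := setVariation_smul_le S (e j) _ (s j)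
          _ ≤ _ := by
              gcongr
              · exact hs j
              · exact hc j
      calc _ ≤ _ := measure_mono hsub
        _ ≤ _ := measure_union_le _ _
        _ ≤ J.card * (ENNReal.ofReal h * c) + ENNReal.ofReal h * c := by
            rw [measure_preimage_add_right]
            exact add_le_add ih hj2
        _ = _ := by
            rw [Finset.card_insert_of_notMem hj]
            push_cast
            rw [add_mul, one_mul]
  have h0 := key Finset.univ
  have hsum : ∑ j, s j • (e j : E d) = s := by
    ext i
    simp [Pi.single_apply]
  rw [hsum] at h0
  simpa using h0

/-- Some sampling of a set is close to it, with an error controlled by its translates. -/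
theorem exists_pixel_close {S : Set (E d)} (hS : MeasurableSet S) {h : ℝ} (hh : 0 < h)
    (n : ℕ+) {c : ℝ≥0∞}
    (hc : ∀ s : E d, (∀ i, |s i| ≤ h) → volume {x | x ∈ cube d n ∧ ¬(x ∈ S ↔ x - s ∈ S)} ≤ c) :
    ∃ τ, volume (symmDiff S (pixel h S τ) ∩ cube d n) ≤ 2 ^ d * c := by
  have hg := measurable_gridPoint (d := d) h
  -- The cube `[-h, h)^d` contains all differences of points in a common cell.
  set Q : Set (E d) := (fun x => x + WithLp.toLp 2 fun _ => h) ⁻¹' cell d (2 * h) with hQ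
  have hQm : MeasurableSet Q := (measurableSet_cell _).preimage (by fun_prop)
  have hQv : volume Q = 2 ^ d * volume (cell d h) := by
    rw [hQ, measure_preimage_add_right, volume_cell hh, volume_cell (by positivity), mul_pow,
      ENNReal.ofReal_mul (by positivity), ENNReal.ofReal_pow (by norm_num), ENNReal.ofReal_ofNat]
  have hQs : ∀ s ∈ Q, ∀ i, |s i| ≤ h := by
    intro s hs i
    have := hs i
    simp only [PiLp.add_apply, mem_Ico] at this
    rw [abs_le]
    constructor <;> linarith [this.1, this.2]
  have hQx : ∀ x y : E d, gridPoint h y = gridPoint h x → x - y ∈ Q := by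
    intro x y hxy i
    have := abs_lt.1 (abs_sub_lt_of_gridPoint_eq hh hxy.symm i)
    simp only [PiLp.add_apply, PiLp.sub_apply, mem_Ico]
    constructor <;> linarith [this.1, this.2]
  set D : Set (E d × E d) := {p | ¬(p.1 ∈ S ↔ p.2 ∈ S)} with hD
  have hDm : MeasurableSet D := by
    have : D = (Prod.fst ⁻¹' S \ Prod.snd ⁻¹' S) ∪ (Prod.snd ⁻¹' S \ Prod.fst ⁻¹' S) := by
      ext p
      simp only [hD, mem_ofPred_eq, mem_union, mem_sdiff, mem_preimage]
      tauto
    rw [this]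
    have a : MeasurableSet (Prod.fst ⁻¹' S : Set (E d × E d)) := hS.preimage measurable_fst
    have b : MeasurableSet (Prod.snd ⁻¹' S : Set (E d × E d)) := hS.preimage measurable_snd
    exact (a.diff b).union (b.diff a)
  have hDi : Measurable (D.indicator (1 : E d × E d → ℝ≥0∞)) := measurable_one.indicator hDm
  have hgrid : ∀ τ, volume (symmDiff S (pixel h S τ) ∩ cube d n) =
      ∫⁻ x in cube d n, D.indicator 1 (x, gridPoint h x + τ) := by
    intro τ
    have hm := hS.symmDiff (measurableSet_pixel h hS τ)
    rw [← Measure.restrict_apply hm, ← lintegral_indicator_one hm]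
    refine lintegral_congr fun x => ?_
    have : x ∈ symmDiff S (pixel h S τ) ↔ (x, gridPoint h x + τ) ∈ D := by
      simp only [mem_symmDiff, pixel, hD, mem_ofPred_eq]
      tauto
    by_cases hx : x ∈ symmDiff S (pixel h S τ)
    · rw [indicator_of_mem hx, indicator_of_mem (this.1 hx)]
      rfl
    · rw [indicator_of_notMem hx, indicator_of_notMem fun h' => hx (this.2 h')]
  have hmeas : Measurable fun τ => volume (symmDiff S (pixel h S τ) ∩ cube d n) := by
    simp only [hgrid]
    exact Measurable.lintegral_prod_right' (f := fun p : E d × E d =>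
      D.indicator (1 : E d × E d → ℝ≥0∞) (p.2, gridPoint h p.2 + p.1))
      (hDi.comp (measurable_snd.prodMk ((hg.comp measurable_snd).add measurable_fst)))
  have hint : ∫⁻ τ in cell d h, volume (symmDiff S (pixel h S τ) ∩ cube d n) ≤
      volume (cell d h) * (2 ^ d * c) := by
    calc ∫⁻ τ in cell d h, volume (symmDiff S (pixel h S τ) ∩ cube d n)
        = ∫⁻ τ in cell d h, ∫⁻ x in cube d n, D.indicator 1 (x, gridPoint h x + τ) :=
          lintegral_congr hgrid
      _ = ∫⁻ x in cube d n, ∫⁻ y in {y | gridPoint h y = gridPoint h x}, D.indicator 1 (x, y) :=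
          lintegral_cell_gridPoint hh (F := fun x y => D.indicator 1 (x, y)) hDi
      _ ≤ ∫⁻ x in cube d n, ∫⁻ s in Q, D.indicator 1 (x, x - s) := by
          refine lintegral_mono fun x => ?_
          have hm : MeasurableSet {y | gridPoint h y = gridPoint h x} :=
            hg (measurableSet_singleton _)
          rw [← lintegral_indicator hm, ← lintegral_indicator hQm,
            ← lintegral_sub_left_eq_self _ x]
          refine lintegral_mono fun s => ?_
          beta_reduce
          by_cases hs : gridPoint h (x - s) = gridPoint h x
          · have hsQ : s ∈ Q := by simpa using hQx x (x - s) hs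
            rw [indicator_of_mem hsQ, indicator_of_mem (show x - s ∈ _ from hs)]
          · rw [indicator_of_notMem (show x - s ∉ _ from hs)]
            exact zero_le
      _ = ∫⁻ s in Q, ∫⁻ x in cube d n, D.indicator 1 (x, x - s) := by
          rw [lintegral_lintegral_swap]
          exact (hDi.comp (measurable_fst.prodMk (measurable_fst.sub measurable_snd))).aemeasurable
      _ ≤ ∫⁻ _s in Q, c := by
          refine setLIntegral_mono' hQm fun s hs => ?_
          have hm : MeasurableSet {x | (x, x - s) ∈ D} :=
            hDm.preimage (measurable_id.prodMk (measurable_id.sub_const s))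
          have : ∫⁻ x in cube d n, D.indicator (1 : E d × E d → ℝ≥0∞) (x, x - s) =
              volume ({x | (x, x - s) ∈ D} ∩ cube d n) := by
            rw [← Measure.restrict_apply hm, ← lintegral_indicator_one hm]
            rfl
          rw [this, inter_comm]
          exact hc s (hQs s hs)
      _ = volume (cell d h) * (2 ^ d * c) := by
          rw [setLIntegral_const, hQv]
          ring
  obtain ⟨τ, -, hτ⟩ := exists_le_setLAverage (volume_cell_ne_zero hh) (volume_cell_ne_top hh)
    hmeas.aemeasurable
  refine ⟨τ, hτ.trans ?_⟩
  rw [setLAverage_eq]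
  refine ENNReal.div_le_of_le_mul ?_
  rwa [mul_comm]

theorem finite_gridPoint_image {h : ℝ} (hh : 0 < h) (n : ℕ+) :
    (gridPoint h '' cube d n).Finite := by
  have hfin : (univ.pi fun _ : Fin d => Icc ⌊-(n : ℝ) / h⌋ ⌊(n : ℝ) / h⌋).Finite :=
    Set.Finite.pi fun _ => finite_Icc _ _
  refine (hfin.image fun k => (WithLp.toLp 2 fun i => h * (k i : ℝ) : E d)).subset ?_
  rintro _ ⟨x, hx, rfl⟩
  refine ⟨fun i => ⌊x i / h⌋, fun i _ => ⟨Int.floor_le_floor ?_, Int.floor_le_floor ?_⟩, rfl⟩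
  · gcongr
    exact (hx i).1.le
  · gcongr
    exact (hx i).2.le

/-- Sets whose variations in all cubes are bounded form a compact set for local convergence in
measure: up to small volume, each is a union of cells of a fixed grid inside a large cube. -/
theorem isCompact_variation_le {c : ℕ+ → ℝ≥0∞} (hc : ∀ n, c n ≠ ∞) :
    IsCompact {A : M d | ∀ n j, variation (e j) (cube d n) A ≤ c n} := by
  refine isCompact_of_forall_net ?_ fun ε hε => ?_
  · simp only [ofPred_forall]
    exact isClosed_iInter fun n => isClosed_iInter fun j =>
      isClosed_variation_le j ⟨cube d n, isWindow_cube d n⟩ (cube_convex d n) (c n)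
  obtain ⟨n, hn⟩ := exists_refMeasure_compl_cube_lt (d := d) (ENNReal.half_pos hε.ne')
  set C : ℝ≥0∞ := 2 * (2 ^ d * (d * c (n + 2))) with hC
  have hCt : C ≠ ∞ :=
    ENNReal.mul_ne_top (by simp) (ENNReal.mul_ne_top (by simp)
      (ENNReal.mul_ne_top (by simp) (hc _)))
  obtain ⟨h, hhC, hh, hh1⟩ : ∃ h : ℝ, ENNReal.ofReal h * C < ε / 2 ∧ 0 < h ∧ h ≤ 1 := by
    have h1 : Filter.Tendsto (fun h : ℝ => ENNReal.ofReal h * C) (𝓝[>] 0) (𝓝 0) := by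
      have h2 : Filter.Tendsto (fun h : ℝ => ENNReal.ofReal h) (𝓝[>] 0) (𝓝 0) := by
        have := (ENNReal.continuous_ofReal.tendsto 0).mono_left (nhdsWithin_le_nhds (s := Ioi 0))
        simpa using this
      simpa using ENNReal.Tendsto.mul_const h2 (Or.inr hCt)
    obtain ⟨h, h2, h3⟩ := ((h1.eventually_lt_const (ENNReal.half_pos hε.ne')).and
      (Ioc_mem_nhdsGT one_pos)).exists
    exact ⟨h, h2, h3.1, h3.2⟩
  have hfin := finite_gridPoint_image (d := d) hh n
  have hm : ∀ T : Finset (E d), MeasurableSet (cube d n ∩ gridPoint h ⁻¹' (T : Set (E d))) :=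
    fun T => (measurableSet_cube n).inter (measurable_gridPoint h T.measurableSet)
  refine ⟨(fun T : Finset (E d) => M.mk _ (hm T).nullMeasurableSet) ''
    (hfin.toFinset.powerset : Set (Finset (E d))), (Finset.finite_toSet _).image _, ?_⟩
  intro A hA
  obtain ⟨S, hS, rfl⟩ := A.exists_rep
  simp only [mem_ofPred_eq, variation_mk] at hA
  obtain ⟨τ, hτ⟩ := exists_pixel_close hS hh n (c := d * (ENNReal.ofReal h * c (n + 2)))
    fun s hs => volume_translate_le hS (hA (n + 2)) hh1 hs
  classical
  refine ⟨_, ⟨hfin.toFinset.filter fun p => p + τ ∈ S, ?_, rfl⟩, ?_⟩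
  · exact Finset.mem_coe.2 (Finset.mem_powerset.2 (Finset.filter_subset _ _))
  · refine (edist_toL1_le hS (hm _) n).trans_lt ?_
    rw [← ENNReal.add_halves ε]
    refine ENNReal.add_lt_add (lt_of_le_of_lt ?_ hhC) hn
    have hsub : volume (symmDiff S (cube d n ∩ gridPoint h ⁻¹'
        ((hfin.toFinset.filter fun p => p + τ ∈ S : Finset (E d)) : Set (E d))) ∩ cube d n) ≤
        volume (symmDiff S (pixel h S τ) ∩ cube d n) := by
      refine measure_mono fun x hx => ?_
      have hxg : gridPoint h x ∈ gridPoint h '' cube d n := mem_image_of_mem _ hx.2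
      have hxn := hx.2
      simp only [mem_inter_iff, mem_symmDiff, mem_preimage, Finset.coe_filter, mem_ofPred_eq,
        Finite.mem_toFinset, hxg, hxn, true_and, pixel, and_true] at hx ⊢
      exact hx
    calc _ ≤ 2 * (2 ^ d * (d * (ENNReal.ofReal h * c (n + 2)))) := by
          gcongr
          exact hsub.trans hτ
      _ = ENNReal.ofReal h * C := by
          rw [hC]
          ring

/-! ### The law of a randomly sampled set -/

theorem measurable_mk_pixel (h : ℝ) {S : Set (E d)} (hS : MeasurableSet S) :
    Measurable fun τ => M.mk (pixel h S τ) (measurableSet_pixel h hS τ).nullMeasurableSet := by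
  have hb : (inferInstance : MeasurableSpace (M d)) = MeasurableSpace.generateFrom
    {V | ∃ (A : M d) (U : Set (E d)) (ε : ℝ≥0∞), IsOpen U ∧ Bornology.IsBounded U ∧ 0 < ε ∧
      V = {B : M d | localDist U A B < ε}} := borel_eq_generateFrom_of_subbasis rfl
  refine Measurable.mono (measurable_generateFrom ?_) le_rfl hb.le
  rintro _ ⟨A, U, ε, hU, -, -, rfl⟩
  obtain ⟨R, hR, rfl⟩ := A.exists_rep
  simp only [preimage_ofPred_eq, localDist_mk]
  refine measurableSet_lt ?_ measurable_const
  have hp := measurable_pixel_prod h hS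
  have hR' : MeasurableSet (Prod.snd ⁻¹' R : Set (E d × E d)) := hR.preimage measurable_snd
  have hU' : MeasurableSet (Prod.snd ⁻¹' U : Set (E d × E d)) :=
    hU.measurableSet.preimage measurable_snd
  exact measurable_measure_prodMk_left ((hR'.symmDiff hp).inter hU')

theorem isBounded_cthickening_frontier (W : Window d) (r : ℝ) :
    Bornology.IsBounded (Metric.cthickening r (frontier W.1)) :=
  (W.2.1.closure.subset frontier_subset_closure).cthickening

/-- Sampling a set at a uniformly distributed offset on the grid of spacing `2⁻ᵏ` gives a random
set whose mean covariogram at grid vectors is close to that of the set, and whose mean variation is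
at most the difference quotient of the set at the scale of the grid. -/
theorem exists_sampling_law (A : M d) (k : ℕ) :
    ∃ Q : Measure (M d), IsProbabilityMeasure Q ∧
      (∀ (y : E d) (W : Window d), (∀ i, ∃ l : ℤ, y i = (2⁻¹ : ℝ) ^ k * l) →
        |∫ B, localCovariogram y W B ∂Q - localCovariogram y W A| ≤
          volume.real (Metric.cthickening ((d + 1) * (2⁻¹ : ℝ) ^ k) (frontier W.1))) ∧
      ∀ (j : Fin d) (n : ℕ+), ∫⁻ B, variation (e j) (cube d n) B ∂Q ≤
        ENNReal.ofReal (sigma (fun y W => localCovariogram y W A) ((2⁻¹ : ℝ) ^ k • e j)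
          ⟨cube d (n + 2), isWindow_cube d (n + 2)⟩ (cube_convex d (n + 2))) := by
  obtain ⟨S, hS, rfl⟩ := A.exists_rep
  set h : ℝ := (2⁻¹ : ℝ) ^ k with hk
  have hh : 0 < h := by positivity
  have hh1 : h ≤ 1 := pow_le_one₀ (by norm_num) (by norm_num)
  have hv0 := volume_cell_ne_zero (d := d) hh
  have hvt := volume_cell_ne_top (d := d) hh
  set D := volume (cell d h) with hD
  have hX := measurable_mk_pixel h hS
  refine ⟨D⁻¹ • (volume.restrict (cell d h)).map
    fun τ => M.mk (pixel h S τ) (measurableSet_pixel h hS τ).nullMeasurableSet, ⟨?_⟩, ?_, ?_⟩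
  · rw [Measure.smul_apply, Measure.map_apply hX MeasurableSet.univ, preimage_univ,
      Measure.restrict_apply_univ, smul_eq_mul, ENNReal.inv_mul_cancel hv0 hvt]
  · intro y W hy
    obtain ⟨h1, h2⟩ := lintegral_covariogram_pixel hS hh hy W
    set I := ∫⁻ τ in cell d h, volume {x | x ∈ pixel h S τ ∧ x - y ∈ pixel h S τ ∧ x ∈ W.1}
      with hI
    set a := volume {x | x ∈ S ∧ x - y ∈ S ∧ x ∈ W.1} with ha
    set b := volume (Metric.cthickening ((d + 1) * h) (frontier W.1)) with hb
    have hat : a ≠ ∞ := measure_ne_top_of_subset (fun x hx => hx.2.2) W.volume_ne_top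
    have hbt : b ≠ ∞ := (isBounded_cthickening_frontier W _).measure_lt_top.ne
    have h3 : D⁻¹ * I ≤ a + b := by
      rw [mul_comm, ← div_eq_mul_inv]
      exact ENNReal.div_le_of_le_mul (by rwa [mul_comm])
    have h4 : a ≤ D⁻¹ * I + b := by
      calc a = D⁻¹ * (D * a) := by rw [← mul_assoc, ENNReal.inv_mul_cancel hv0 hvt, one_mul]
        _ ≤ D⁻¹ * (I + D * b) := by gcongr
        _ = D⁻¹ * I + b := by
            rw [mul_add, ← mul_assoc, ENNReal.inv_mul_cancel hv0 hvt, one_mul]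
    have hint : ∫ B, localCovariogram y W B ∂(D⁻¹ • (volume.restrict (cell d h)).map
        fun τ => M.mk (pixel h S τ) (measurableSet_pixel h hS τ).nullMeasurableSet) =
        (D⁻¹ * I).toReal := by
      rw [integral_smul_measure, integral_map hX.aemeasurable
        (continuous_localCovariogram y W).aestronglyMeasurable, ENNReal.toReal_mul, smul_eq_mul]
      congr 1
      have hmt : Measurable fun τ => localCovariogram y W
          (M.mk (pixel h S τ) (measurableSet_pixel h hS τ).nullMeasurableSet) :=
        (continuous_localCovariogram y W).measurable.comp hX
      rw [integral_eq_lintegral_of_nonneg_ae (ae_of_all _ fun τ => localCovariogram_nonneg _ _ _)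
        hmt.aestronglyMeasurable]
      congr 1
      refine lintegral_congr fun τ => ?_
      rw [localCovariogram_mk, Measure.real, ENNReal.ofReal_toReal]
      exact measure_ne_top_of_subset (fun x hx => hx.2.2) W.volume_ne_top
    have hqt : D⁻¹ * I ≠ ∞ := (h3.trans_lt (ENNReal.add_lt_top.2 ⟨hat.lt_top, hbt.lt_top⟩)).ne
    rw [hint, localCovariogram_mk, abs_sub_le_iff, Measure.real, Measure.real]
    have h5 := ENNReal.toReal_mono (ENNReal.add_ne_top.2 ⟨hat, hbt⟩) h3
    have h6 := ENNReal.toReal_mono (ENNReal.add_ne_top.2 ⟨hqt, hbt⟩) h4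
    rw [ENNReal.toReal_add hat hbt] at h5
    rw [ENNReal.toReal_add hqt hbt] at h6
    constructor <;> linarith
  · intro j n
    have hV := measurable_variation j ⟨cube d n, isWindow_cube d n⟩ (cube_convex d n)
    rw [lintegral_smul_measure, lintegral_map hV hX, ofReal_sigma_dyadic hS, smul_eq_mul]
    simp only [variation_eq_iSup _ j ⟨cube d n, isWindow_cube d n⟩ (cube_convex d n),
      ofReal_sigma_dyadic (measurableSet_pixel h hS _)]
    have hmeas : ∀ m : ℕ, Measurable fun τ => (2 : ℝ≥0∞) ^ m *
        jumpVol (pixel h S τ) ((2⁻¹ : ℝ) ^ m • e j) (cube d n) := by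
      intro m
      simp only [← ofReal_sigma_dyadic (measurableSet_pixel h hS _) j
        ⟨cube d n, isWindow_cube d n⟩ (cube_convex d n)]
      exact (ENNReal.continuous_ofReal.comp (continuous_sigma _ _ _)).measurable.comp hX
    rw [lintegral_iSup hmeas fun m m' hmm τ =>
      monotone_dyadic_jumpVol (pixel h S τ) (e j) (cube_convex d n) hmm, ENNReal.mul_iSup]
    refine iSup_le fun m => ?_
    -- By monotonicity in `m` it suffices to treat steps shorter than the grid spacing.
    set m' := max m k with hm'
    have hle : ∫⁻ τ in cell d h, (2 : ℝ≥0∞) ^ m *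
        jumpVol (pixel h S τ) ((2⁻¹ : ℝ) ^ m • e j) (cube d n) ≤
        (2 : ℝ≥0∞) ^ m' * ∫⁻ τ in cell d h,
          jumpVol (pixel h S τ) ((2⁻¹ : ℝ) ^ m' • e j) (cube d n) := by
      rw [← lintegral_const_mul' _ _ (by simp)]
      exact lintegral_mono fun τ =>
        monotone_dyadic_jumpVol (pixel h S τ) (e j) (cube_convex d n) (le_max_left m k)
    have hp := lintegral_jumpVol_pixel_le hS hh hh1 (ε := (2⁻¹ : ℝ) ^ m') (by positivity)
      (pow_le_pow_of_le_one (by norm_num) (by norm_num) (le_max_right m k)) j n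
    set I := ∫⁻ τ in cell d h, jumpVol (pixel h S τ) ((2⁻¹ : ℝ) ^ m' • e j) (cube d n) with hI
    have hpow : ∀ l : ℕ, (2 : ℝ≥0∞) ^ l * ENNReal.ofReal ((2⁻¹ : ℝ) ^ l) = 1 := by
      intro l
      rw [ENNReal.ofReal_pow (by norm_num), ENNReal.ofReal_inv_of_pos (by norm_num),
        ENNReal.ofReal_ofNat, ← mul_pow, ENNReal.mul_inv_cancel (by simp) (by simp), one_pow]
    set J := jumpVol S (h • e j) (cube d (n + 2)) with hJ
    calc D⁻¹ * _ ≤ D⁻¹ * (2 ^ m' * I) := by gcongr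
      _ = D⁻¹ * (2 ^ m' * (2 ^ k * ENNReal.ofReal h * I)) := by rw [hpow, one_mul]
      _ = D⁻¹ * (2 ^ m' * (2 ^ k * (ENNReal.ofReal h * I))) := by ring
      _ ≤ D⁻¹ * (2 ^ m' * (2 ^ k * (ENNReal.ofReal ((2⁻¹ : ℝ) ^ m') * D * J))) := by gcongr
      _ = (D⁻¹ * D) * (2 ^ m' * ENNReal.ofReal ((2⁻¹ : ℝ) ^ m')) * (2 ^ k * J) := by ring
      _ = 2 ^ k * J := by rw [hpow, ENNReal.inv_mul_cancel hv0 hvt, one_mul, one_mul]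

/-! ### Admissible functions as limits of mean covariograms -/

/-- By Hahn–Banach separation in finite dimension, an admissible function is approximated on finite
sets by finite convex combinations of covariograms. -/
theorem Admissible.exists_convex_approx {γ : E d → Window d → ℝ} (hγ : Admissible γ)
    (F : Finset (E d × Window d)) {η : ℝ} (hη : 0 < η) :
    ∃ (κ : Type) (_ : Fintype κ) (w : κ → ℝ) (A : κ → M d), (∀ i, 0 ≤ w i) ∧ ∑ i, w i = 1 ∧
      ∀ p ∈ F, |∑ i, w i * localCovariogram p.1 p.2 (A i) - γ p.1 p.2| ≤ η := by
  classical
  set V : M d → (F → ℝ) := fun A p => localCovariogram p.1.1 p.1.2 A with hV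
  set v : F → ℝ := fun p => γ p.1.1 p.1.2 with hv
  have hmem : v ∈ closure (convexHull ℝ (range V)) := by
    by_contra hnot
    obtain ⟨f, u, hfu, hfV⟩ := geometric_hahn_banach_point_closed
      (convex_convexHull ℝ (range V)).closure isClosed_closure hnot
    set a : F → ℝ := fun p => f fun q => if p = q then 1 else 0 with ha
    have hsum : ∀ z : F → ℝ, f z = ∑ p, a p * z p := by
      intro z
      refine (LinearMap.pi_apply_eq_sum_univ f.toLinearMap z).trans ?_
      exact Finset.sum_congr rfl fun p _ => mul_comm _ _
    have hne : F.Nonempty := by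
      by_contra hemp
      rw [Finset.not_nonempty_iff_eq_empty] at hemp
      subst hemp
      have h1 := hfV (V (M.mk ∅ MeasurableSet.empty.nullMeasurableSet))
        (subset_closure (subset_convexHull ℝ _ (mem_range_self _)))
      rw [hsum] at h1 hfu
      simp only [Finset.univ_eq_empty, Finset.sum_empty] at h1 hfu
      linarith
    have e := F.equivFin
    have h2 := hγ F.card hne.card_pos (fun i => a (e.symm i))
      (fun i => (e.symm i).1.1) (fun i => (e.symm i).1.2) (-u) (fun A => by
        have h1 := hfV (V A) (subset_closure (subset_convexHull ℝ _ (mem_range_self A)))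
        rw [hsum, ← Equiv.sum_comp e.symm] at h1
        linarith)
    rw [hsum, ← Equiv.sum_comp e.symm] at hfu
    linarith
  obtain ⟨z, hz, hzd⟩ := Metric.mem_closure_iff.1 hmem η hη
  obtain ⟨κ, hκ, w, x, hw0, hw1, hx, rfl⟩ := mem_convexHull_iff_exists_fintype.1 hz
  choose A hA using hx
  refine ⟨κ, hκ, w, A, hw0, hw1, fun p hp => ?_⟩
  have h1 := (dist_le_pi_dist v (∑ i, w i • x i) ⟨p, hp⟩).trans hzd.le
  rw [dist_comm, Real.dist_eq] at h1
  simpa [← hA, hV, hv] using h1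

theorem sigma_sum {κ : Type*} [Fintype κ] (w : κ → ℝ) (g : κ → E d → Window d → ℝ) (u : E d)
    (W : Window d) (hc : Convex ℝ W.1) :
    sigma (fun y W' => ∑ i, w i * g i y W') u W hc = ∑ i, w i * sigma (g i) u W hc := by
  unfold sigma
  simp only [← Finset.sum_sub_distrib, ← Finset.sum_add_distrib, Finset.mul_sum]
  exact Finset.sum_congr rfl fun i _ => by ring

/-- The sum of the variations of a class in all cubes, with weights that take into account the loss
of two units in the size of the cube when a set is sampled on a grid. -/
noncomputable def weightedVariation (A : M d) : ℝ≥0∞ :=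
  ∑' n : ℕ+, weight d (n + 2) * ∑ j, variation (e j) (cube d n) A

/-- The sum over all cubes of the difference quotients of `γ` at scale `2⁻ᵏ`. -/
noncomputable def weightedQuotient (k : ℕ) (γ : E d → Window d → ℝ) (n : ℕ+) : ℝ≥0∞ :=
  weight d n * ∑ j, ENNReal.ofReal (sigma γ ((2⁻¹ : ℝ) ^ k • e j) ⟨cube d n, isWindow_cube d n⟩
    (cube_convex d n))

theorem weightedQuotient_le (k : ℕ) (A : M d) (n : ℕ+) :
    weightedQuotient k (fun y W => localCovariogram y W A) n ≤ d * 2 ^ k * 2⁻¹ ^ (n : ℕ) := by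
  obtain ⟨S, hS, rfl⟩ := A.exists_rep
  unfold weightedQuotient
  simp only [ofReal_sigma_dyadic hS]
  calc _ ≤ weight d n * ∑ _j : Fin d, (2 : ℝ≥0∞) ^ k * volume (cube d n) := by
        gcongr
        exact jumpVol_le _ _ _
    _ = d * 2 ^ k * (weight d n * volume (cube d n)) := by
        rw [Finset.sum_const, Finset.card_univ, Fintype.card_fin, nsmul_eq_mul]
        ring
    _ = _ := by rw [weight_mul_volume_cube]

theorem weightedQuotient_le_L (k : ℕ) (γ : E d → Window d → ℝ) (n : ℕ+) :
    weightedQuotient k γ n ≤ weight d n *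
      ∑ j, L j γ ⟨cube d n, isWindow_cube d n⟩ (cube_convex d n) := by
  unfold weightedQuotient
  gcongr with j
  exact le_iSup₂_of_le ((2⁻¹ : ℝ) ^ k) (by positivity) le_rfl

theorem sum_weightedQuotient {κ : Type*} [Fintype κ] {w : κ → ℝ} (hw : ∀ i, 0 ≤ w i)
    (A : κ → M d) (k : ℕ) (n : ℕ+) :
    weightedQuotient k (fun y W => ∑ i, w i * localCovariogram y W (A i)) n =
      ∑ i, ENNReal.ofReal (w i) * weightedQuotient k (fun y W => localCovariogram y W (A i)) n := by
  unfold weightedQuotient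
  simp only [sigma_sum w fun i y W => localCovariogram y W (A i)]
  simp only [ENNReal.ofReal_sum_of_nonneg fun i _ =>
    mul_nonneg (hw i) (sigma_localCovariogram_nonneg (A i) _ _ _),
    ENNReal.ofReal_mul (hw _), Finset.mul_sum]
  rw [Finset.sum_comm]
  exact Finset.sum_congr rfl fun i _ => Finset.sum_congr rfl fun j _ => by ring

/-- The vectors at which the difference quotient at scale `2⁻ᵏ` in direction `e_j` evaluates a
covariogram. -/
noncomputable def quotientVectors (k : ℕ) (j : Fin d) : Set (E d) :=
  {0, (2⁻¹ : ℝ) ^ k • e j, -((2⁻¹ : ℝ) ^ k • e j)}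

/-- The windows at which the difference quotient at scale `2⁻ᵏ` in direction `e_j` on the cube `U_n`
evaluates a covariogram. -/
noncomputable def quotientWindows (k : ℕ) (j : Fin d) (n : ℕ+) : Set (Window d) :=
  {erode ⟨cube d n, isWindow_cube d n⟩ (cube_convex d n) (-((2⁻¹ : ℝ) ^ k • e j)) 0,
    erode ⟨cube d n, isWindow_cube d n⟩ (cube_convex d n) 0 ((2⁻¹ : ℝ) ^ k • e j)}

/-- Functions that are uniformly close on the relevant arguments have close quotients. -/
theorem weightedQuotient_le_add (k : ℕ) {γ g : E d → Window d → ℝ} (n : ℕ+) {η : ℝ}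
    (h : ∀ j : Fin d, ∀ y ∈ quotientVectors k j, ∀ W ∈ quotientWindows k j n,
      |g y W - γ y W| ≤ η) :
    weightedQuotient k g n ≤ weightedQuotient k γ n +
      weight d n * ENNReal.ofReal (d * (2 ^ k * (4 * η))) := by
  unfold weightedQuotient
  have hj : ∀ j : Fin d, ENNReal.ofReal (sigma g ((2⁻¹ : ℝ) ^ k • e j)
      ⟨cube d n, isWindow_cube d n⟩ (cube_convex d n)) ≤
      ENNReal.ofReal (sigma γ ((2⁻¹ : ℝ) ^ k • e j) ⟨cube d n, isWindow_cube d n⟩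
        (cube_convex d n)) + ENNReal.ofReal (2 ^ k * (4 * η)) := by
    intro j
    refine le_trans (ENNReal.ofReal_le_ofReal ?_) ENNReal.ofReal_add_le
    have h1 := abs_le.1 (h j 0 (Or.inl rfl) _ (Or.inl rfl))
    have h2 := abs_le.1 (h j _ (Or.inr (Or.inl rfl)) _ (Or.inl rfl))
    have h3 := abs_le.1 (h j 0 (Or.inl rfl) _ (Or.inr rfl))
    have h4 := abs_le.1 (h j _ (Or.inr (Or.inr rfl)) _ (Or.inr rfl))
    have hn : 1 / ‖(2⁻¹ : ℝ) ^ k • (e j : E d)‖ = 2 ^ k := by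
      rw [norm_smul, norm_e, mul_one, norm_pow, norm_inv, Real.norm_ofNat, one_div, inv_pow, inv_inv]
    unfold sigma
    rw [hn, ← mul_add]
    refine mul_le_mul_of_nonneg_left ?_ (by positivity)
    linarith [h1.2, h2.1, h3.2, h4.1]
  calc _ ≤ weight d n * ∑ j : Fin d, (ENNReal.ofReal (sigma γ ((2⁻¹ : ℝ) ^ k • e j)
        ⟨cube d n, isWindow_cube d n⟩ (cube_convex d n)) + ENNReal.ofReal (2 ^ k * (4 * η))) := by
        gcongr with j
        exact hj j
    _ = _ := by
        rw [Finset.sum_add_distrib, mul_add, Finset.sum_const, Finset.card_univ, Fintype.card_fin,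
          nsmul_eq_mul, ENNReal.ofReal_mul (p := (d : ℝ)) (by positivity), ENNReal.ofReal_natCast]

theorem measurable_weightedVariation : Measurable (weightedVariation (d := d)) :=
  Measurable.tsum fun n => (Finset.measurable_sum _ fun j _ =>
    measurable_variation j ⟨cube d n, isWindow_cube d n⟩ (cube_convex d n)).const_mul _

/-- Convex combinations of covariograms can be chosen to approximate an admissible function on a
finite set, and at the same time its difference quotients at a given scale on finitely many cubes. -/
theorem Admissible.exists_convex_approx_finset {γ : E d → Window d → ℝ} (hγ : Admissible γ)
    (F : Finset (E d × Window d)) (T : Finset ℕ+) (k : ℕ) {η : ℝ} (hη : 0 < η) :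
    ∃ (κ : Type) (_ : Fintype κ) (w : κ → ℝ) (A : κ → M d), (∀ i, 0 ≤ w i) ∧ ∑ i, w i = 1 ∧
      (∀ p ∈ F, |∑ i, w i * localCovariogram p.1 p.2 (A i) - γ p.1 p.2| ≤ η) ∧
      ∀ n ∈ T, weightedQuotient k (fun y W => ∑ i, w i * localCovariogram y W (A i)) n ≤
        weightedQuotient k γ n + weight d n * ENNReal.ofReal (d * (2 ^ k * (4 * η))) := by
  have hfin : ((⋃ q ∈ (T : Set ℕ+) ×ˢ (univ : Set (Fin d)),
      quotientVectors k q.2 ×ˢ quotientWindows k q.2 q.1) ∪ (F : Set (E d × Window d))).Finite := by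
    refine Finite.union (Finite.biUnion (T.finite_toSet.prod finite_univ) fun q _ => ?_)
      F.finite_toSet
    unfold quotientVectors quotientWindows
    exact (toFinite _).prod (toFinite _)
  obtain ⟨κ, hκ, w, A, hw0, hw1, hwA⟩ := hγ.exists_convex_approx hfin.toFinset hη
  refine ⟨κ, hκ, w, A, hw0, hw1, fun p hp => hwA p (hfin.mem_toFinset.2 (Or.inr hp)),
    fun n hn => ?_⟩
  refine weightedQuotient_le_add k n fun j y hy W hW => ?_
  have hmem : (y, W) ∈ hfin.toFinset := by
    rw [Finite.mem_toFinset]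
    left
    rw [mem_iUnion₂]
    exact ⟨(n, j), mk_mem_prod hn (mem_univ j), mk_mem_prod hy hW⟩
  exact hwA (y, W) hmem

/-- An exchange of sums: the means of the terms `f i n` are bounded for `n ∈ T` by hypothesis, and
the terms outside `T` are uniformly small. -/
theorem sum_mul_tsum_le {κ : Type*} [Fintype κ] {c : κ → ℝ≥0∞} (hc : ∑ i, c i = 1)
    {f : κ → ℕ+ → ℝ≥0∞} {t l β : ℕ+ → ℝ≥0∞} {R δ : ℝ≥0∞} (T : Finset ℕ+)
    (hT : ∑' n : {n // n ∉ T}, t n ≤ 1) (hf : ∀ i n, f i n ≤ t n)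
    (hfT : ∀ n ∈ T, ∑ i, c i * f i n ≤ l n + β n * δ) (hl : ∑' n, l n ≤ R)
    (hβ : ∑' n, β n ≤ 2) (hδ : 2 * δ ≤ 1) : ∑ i, c i * ∑' n, f i n ≤ R + 2 := by
  have h1 : ∀ i, ∑' n, f i n ≤ ∑ n ∈ T, f i n + 1 := by
    intro i
    rw [← ENNReal.sum_add_tsum_compl T]
    refine add_le_add_right ?_ _
    exact (ENNReal.tsum_le_tsum fun n : ((T : Set ℕ+)ᶜ : Set ℕ+) => hf i n).trans hT
  calc _ ≤ ∑ i, c i * (∑ n ∈ T, f i n + 1) :=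
        Finset.sum_le_sum fun i _ => mul_le_mul_right (h1 i) _
    _ = ∑ n ∈ T, ∑ i, c i * f i n + 1 := by
        simp only [mul_add, Finset.sum_add_distrib, mul_one, hc, Finset.mul_sum]
        rw [Finset.sum_comm]
    _ ≤ ∑ n ∈ T, (l n + β n * δ) + 1 := add_le_add_left (Finset.sum_le_sum hfT) 1
    _ ≤ R + 1 + 1 := by
        rw [Finset.sum_add_distrib, ← Finset.sum_mul]
        refine add_le_add_left (add_le_add ((ENNReal.sum_le_tsum T).trans hl) ?_) 1
        exact (mul_le_mul_left ((ENNReal.sum_le_tsum T).trans hβ) δ).trans hδ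
    _ = R + 2 := by rw [add_assoc, one_add_one_eq_two]

/-- An admissible function is approximated on finite sets by convex combinations of covariograms
whose difference quotients at a given scale are controlled by the constants `L_j`. -/
theorem Admissible.exists_convex_approx_quotient {γ : E d → Window d → ℝ} (hγ : Admissible γ)
    {R : ℝ≥0∞} (hR : ∑' n : ℕ+, weight d n *
      ∑ j : Fin d, L j γ ⟨cube d n, isWindow_cube d n⟩ (cube_convex d n) ≤ R)
    (F : Finset (E d × Window d)) (k : ℕ) {η : ℝ} (hη : 0 < η) :
    ∃ (κ : Type) (_ : Fintype κ) (w : κ → ℝ) (A : κ → M d), (∀ i, 0 ≤ w i) ∧ ∑ i, w i = 1 ∧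
      (∀ p ∈ F, |∑ i, w i * localCovariogram p.1 p.2 (A i) - γ p.1 p.2| ≤ η) ∧
      ∑ i, ENNReal.ofReal (w i) *
        ∑' n : ℕ+, weightedQuotient k (fun y W => localCovariogram y W (A i)) n ≤ R + 2 := by
  -- The contribution of large cubes is negligible at the fixed scale `2⁻ᵏ`.
  obtain ⟨T, hT⟩ : ∃ T : Finset ℕ+,
      ∑' n : {n // n ∉ T}, (d * 2 ^ k * 2⁻¹ ^ (n : ℕ) : ℝ≥0∞) ≤ 1 := by
    have hfin : ∑' n : ℕ+, (d * 2 ^ k * 2⁻¹ ^ (n : ℕ) : ℝ≥0∞) ≠ ∞ := by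
      rw [ENNReal.tsum_mul_left]
      exact ENNReal.mul_ne_top (ENNReal.mul_ne_top (by simp) (by simp))
        (tsum_two_inv_pow_le.trans_lt (by simp)).ne
    exact ((ENNReal.tendsto_tsum_compl_atTop_zero hfin).eventually_le_const
      (by simp : (0 : ℝ≥0∞) < 1)).exists
  -- The error in the quotients at scale `2⁻ᵏ` has to be at most `1` in total.
  obtain ⟨η', hη'0, hη'η, hη'⟩ : ∃ η' : ℝ, 0 < η' ∧ η' ≤ η ∧ η' ≤ 1 / (8 * (d + 1) * 2 ^ k) :=
    ⟨min η (1 / (8 * (d + 1) * 2 ^ k)), lt_min hη (by positivity), min_le_left _ _,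
      min_le_right _ _⟩
  obtain ⟨κ, hκ, w, A, hw0, hw1, hwA, hwT⟩ := hγ.exists_convex_approx_finset F T k hη'0
  refine ⟨κ, hκ, w, A, hw0, hw1, fun p hp => (hwA p hp).trans hη'η, ?_⟩
  have hwsum : ∑ i, ENNReal.ofReal (w i) = 1 := by
    rw [← ENNReal.ofReal_sum_of_nonneg fun i _ => hw0 i, hw1, ENNReal.ofReal_one]
  refine sum_mul_tsum_le (t := fun n => d * 2 ^ k * 2⁻¹ ^ (n : ℕ)) (β := weight d) hwsum T hT
    (fun i n => weightedQuotient_le k (A i) n)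
    (fun n hn => ?_) hR tsum_weight_le (δ := ENNReal.ofReal (d * (2 ^ k * (4 * η')))) ?_
  · rw [← sum_weightedQuotient hw0]
    exact (hwT n hn).trans (add_le_add_left (weightedQuotient_le_L k γ n) _)
  · have h8 : (d : ℝ) * (2 ^ k * (4 * η')) ≤ 2⁻¹ := by
      rw [le_div_iff₀ (by positivity)] at hη'
      have : (0 : ℝ) ≤ 2 ^ k * η' := by positivity
      nlinarith
    calc _ ≤ 2 * ENNReal.ofReal (2⁻¹ : ℝ) := mul_le_mul_right (ENNReal.ofReal_le_ofReal h8) _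
      _ = 1 := by
          rw [ENNReal.ofReal_inv_of_pos (by norm_num), ENNReal.ofReal_ofNat,
            ENNReal.mul_inv_cancel (by simp) (by simp)]

/-- The constants `L_j` control the mean weighted variation of suitable random sets whose mean
covariogram is close to `γ`. -/
theorem Admissible.exists_approx_law {γ : E d → Window d → ℝ} (hγ : Admissible γ) {R : ℝ≥0∞}
    (hR : ∑' n : ℕ+, weight d n *
      ∑ j : Fin d, L j γ ⟨cube d n, isWindow_cube d n⟩ (cube_convex d n) ≤ R)
    (F : Finset (E d × Window d)) (k : ℕ) {η : ℝ} (hη : 0 < η) :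
    ∃ Q : Measure (M d), IsProbabilityMeasure Q ∧
      (∀ p ∈ F, (∀ i, ∃ l : ℤ, p.1 i = (2⁻¹ : ℝ) ^ k * l) →
        |∫ B, localCovariogram p.1 p.2 B ∂Q - γ p.1 p.2| ≤
          volume.real (Metric.cthickening ((d + 1) * (2⁻¹ : ℝ) ^ k) (frontier p.2.1)) + η) ∧
      ∫⁻ B, weightedVariation B ∂Q ≤ R + 2 := by
  obtain ⟨κ, hκ, w, A, hw0, hw1, hwA, hwR⟩ := hγ.exists_convex_approx_quotient hR F k hη
  choose Q hQ hQδ hQV using fun i => exists_sampling_law (A i) k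
  have hint : ∀ (y : E d) (W : Window d) i, Integrable (fun B => localCovariogram y W B)
      (ENNReal.ofReal (w i) • Q i) := fun y W i =>
    Integrable.smul_measure (integrable_localCovariogram (Q i) measurable_id y W)
      ENNReal.ofReal_ne_top
  refine ⟨∑ i, ENNReal.ofReal (w i) • Q i, ⟨?_⟩, ?_, ?_⟩
  · simp only [Measure.finsetSum_apply, Measure.smul_apply, measure_univ, smul_eq_mul, mul_one]
    rw [← ENNReal.ofReal_sum_of_nonneg fun i _ => hw0 i, hw1, ENNReal.ofReal_one]
  · intro p hp hgrid
    rw [integral_finsetSum_measure fun i _ => hint _ _ i]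
    simp only [integral_smul_measure, ENNReal.toReal_ofReal (hw0 _), smul_eq_mul]
    have h2 : |∑ i, w i * ∫ B, localCovariogram p.1 p.2 B ∂(Q i) -
        ∑ i, w i * localCovariogram p.1 p.2 (A i)| ≤
        volume.real (Metric.cthickening ((d + 1) * (2⁻¹ : ℝ) ^ k) (frontier p.2.1)) := by
      rw [← Finset.sum_sub_distrib]
      calc _ ≤ ∑ i, |w i * ∫ B, localCovariogram p.1 p.2 B ∂(Q i) -
            w i * localCovariogram p.1 p.2 (A i)| := Finset.abs_sum_le_sum_abs _ _
        _ ≤ ∑ i, w i * volume.real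
            (Metric.cthickening ((d + 1) * (2⁻¹ : ℝ) ^ k) (frontier p.2.1)) := by
            refine Finset.sum_le_sum fun i _ => ?_
            rw [← mul_sub, abs_mul, abs_of_nonneg (hw0 i)]
            exact mul_le_mul_of_nonneg_left (hQδ i p.1 p.2 hgrid) (hw0 i)
        _ = _ := by rw [← Finset.sum_mul, hw1, one_mul]
    calc _ ≤ _ := abs_sub_le _ (∑ i, w i * localCovariogram p.1 p.2 (A i)) _
      _ ≤ _ := add_le_add h2 (hwA p hp)
  · rw [lintegral_finsetSum_measure]
    simp only [lintegral_smul_measure, smul_eq_mul]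
    refine (Finset.sum_le_sum fun i _ => mul_le_mul' le_rfl ?_).trans hwR
    unfold weightedVariation
    have hm : ∀ (n : ℕ+) (j : Fin d), Measurable fun B : M d => variation (e j) (cube d n) B :=
      fun n j => measurable_variation j ⟨cube d n, isWindow_cube d n⟩ (cube_convex d n)
    rw [lintegral_tsum fun n =>
      ((Finset.measurable_sum _ fun j _ => hm n j).const_mul _).aemeasurable]
    calc _ ≤ ∑' n : ℕ+, weightedQuotient k (fun y W => localCovariogram y W (A i)) (n + 2) := by
          refine ENNReal.tsum_le_tsum fun n => ?_
          rw [lintegral_const_mul _ (Finset.measurable_sum _ fun j _ => hm n j),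
            lintegral_finsetSum _ fun j _ => hm n j]
          unfold weightedQuotient
          gcongr with j
          exact hQV i j n
      _ ≤ ∑' n : ℕ+, weightedQuotient k (fun y W => localCovariogram y W (A i)) n :=
          ENNReal.tsum_comp_le_tsum_of_injective (add_left_injective (2 : ℕ+)) _

/-! ### A random set with prescribed mean covariogram at dyadic vectors -/

/-- A real number is dyadic if it is an integral multiple of `2⁻ᵏ` for all large `k`. -/
def IsDyadic (x : ℝ) : Prop := ∀ᶠ k : ℕ in Filter.atTop, ∃ l : ℤ, x = (2⁻¹ : ℝ) ^ k * l

theorem isDyadic_pow_mul (k : ℕ) (l : ℤ) : IsDyadic ((2⁻¹ : ℝ) ^ k * l) := by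
  filter_upwards [Filter.eventually_ge_atTop k] with m hm
  obtain ⟨i, rfl⟩ := Nat.exists_eq_add_of_le hm
  refine ⟨2 ^ i * l, ?_⟩
  have : (2⁻¹ : ℝ) ^ i * 2 ^ i = 1 := by rw [← mul_pow]; norm_num
  push_cast
  rw [pow_add]
  linear_combination (-(2⁻¹ : ℝ) ^ k * l) * this

theorem IsDyadic.neg {x : ℝ} (h : IsDyadic x) : IsDyadic (-x) := by
  filter_upwards [h] with k hk
  obtain ⟨l, rfl⟩ := hk
  exact ⟨-l, by push_cast; ring⟩

theorem isDyadic_zero : IsDyadic 0 := by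
  simpa using isDyadic_pow_mul 0 0

theorem isDyadic_smul_e (m : ℕ) (j i : Fin d) : IsDyadic (((2⁻¹ : ℝ) ^ m • e j : E d) i) := by
  by_cases hij : i = j
  · subst hij
    simpa using isDyadic_pow_mul m 1
  · simpa [hij] using isDyadic_zero

theorem exists_isDyadic_add (x : ℝ) {δ : ℝ} (hδ : 0 < δ) :
    ∃ ε, 0 < ε ∧ ε ≤ δ ∧ IsDyadic (x + ε) := by
  obtain ⟨k, hk⟩ := exists_pow_lt_of_lt_one hδ (by norm_num : (2⁻¹ : ℝ) < 1)
  have hp : (0 : ℝ) < 2⁻¹ ^ k := by positivity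
  have hk2 : (2⁻¹ : ℝ) ^ k * 2 ^ k = 1 := by rw [← mul_pow]; norm_num
  have hx : x = (2⁻¹ : ℝ) ^ k * (x * 2 ^ k) := by linear_combination -x * hk2
  refine ⟨(2⁻¹ : ℝ) ^ k * (⌊x * 2 ^ k⌋ + 1 : ℤ) - x, ?_, ?_, ?_⟩
  · have := mul_lt_mul_of_pos_left (Int.lt_floor_add_one (x * 2 ^ k)) hp
    push_cast
    linarith
  · have := mul_le_mul_of_nonneg_left (Int.floor_le (x * 2 ^ k)) hp.le
    push_cast
    linarith
  · rw [add_sub_cancel]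
    exact isDyadic_pow_mul _ _

/-- Markov's inequality: a law with finite mean weighted variation is concentrated on a compact
set of classes with bounded variations. -/
theorem measure_compl_variation_le (Q : Measure (M d)) {R : ℝ≥0∞}
    (hR : ∫⁻ B, weightedVariation B ∂Q ≤ R) {c : ℝ≥0∞} (hc0 : c ≠ 0) (hc : c ≠ ∞) :
    Q {A | ∀ n j, variation (e j) (cube d n) A ≤ c / weight d (n + 2)}ᶜ ≤ R / c := by
  refine le_trans (measure_mono fun A hA => ?_)
    ((meas_ge_le_lintegral_div measurable_weightedVariation.aemeasurable hc0 hc).trans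
      (ENNReal.div_le_div_right hR c))
  simp only [mem_compl_iff, mem_ofPred_eq, not_forall, not_le] at hA
  obtain ⟨n, j, hnj⟩ := hA
  rw [ENNReal.div_lt_iff (Or.inl (weight_ne_zero _)) (Or.inl (weight_ne_top _))] at hnj
  refine hnj.le.trans ?_
  rw [mul_comm]
  refine le_trans ?_ (ENNReal.le_tsum n)
  gcongr
  exact Finset.single_le_sum (f := fun j => variation (e j) (cube d n) A) (fun _ _ => zero_le)
    (Finset.mem_univ j)

theorem tendsto_volume_cthickening_frontier (W : Window d) :
    Filter.Tendsto (fun k : ℕ =>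
      volume.real (Metric.cthickening ((d + 1) * (2⁻¹ : ℝ) ^ k) (frontier W.1)))
      Filter.atTop (𝓝 0) := by
  have hK : IsCompact (frontier W.1) :=
    Metric.isCompact_of_isClosed_isBounded isClosed_frontier
      (W.2.1.closure.subset frontier_subset_closure)
  have h1 := tendsto_measure_cthickening_of_isCompact (μ := volume) hK
  rw [W.2.2.2] at h1
  have h2 : Filter.Tendsto (fun k : ℕ => ((d : ℝ) + 1) * (2⁻¹ : ℝ) ^ k) Filter.atTop (𝓝 0) := by
    simpa using (tendsto_pow_atTop_nhds_zero_of_lt_one (r := (2⁻¹ : ℝ)) (by norm_num)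
      (by norm_num)).const_mul ((d : ℝ) + 1)
  exact (ENNReal.tendsto_toReal (by simp)).comp (h1.comp h2)

theorem isClosed_integral_localCovariogram (y : E d) (W : Window d) (x η : ℝ) :
    IsClosed {P : ProbabilityMeasure (M d) |
      |∫ B, localCovariogram y W B ∂(P : Measure (M d)) - x| ≤ η} := by
  let f : BoundedContinuousFunction (M d) ℝ :=
    BoundedContinuousFunction.ofNormedAddCommGroup (localCovariogram y W)
      (continuous_localCovariogram y W) (volume.real W.1) fun A => by
        rw [Real.norm_of_nonneg (localCovariogram_nonneg _ _ _)]
        exact localCovariogram_le _ _ _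
  have hf := ProbabilityMeasure.continuous_integral_boundedContinuousFunction f
  exact isClosed_le ((hf.sub continuous_const).abs) continuous_const

/-- Prokhorov's theorem produces, from the approximating laws, a law whose mean covariogram is
exactly `γ` at all dyadic vectors. -/
theorem Admissible.exists_law {γ : E d → Window d → ℝ} (hγ : Admissible γ) {R : ℝ≥0∞}
    (hRf : R ≠ ∞) (hR : ∑' n : ℕ+, weight d n *
      ∑ j : Fin d, L j γ ⟨cube d n, isWindow_cube d n⟩ (cube_convex d n) ≤ R) :
    ∃ P : Measure (M d), IsProbabilityMeasure P ∧
      ∀ y W, (∀ i, IsDyadic (y i)) → meanCovariogram P id y W = γ y W := by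
  lift R to NNReal using hRf
  set K : ℕ → Set (M d) := fun m =>
    {A | ∀ n j, variation (e j) (cube d n) A ≤ ((m + 1 : NNReal) : ℝ≥0∞) / weight d (n + 2)} with hK
  have hKc : ∀ m, IsCompact (K m) := fun m =>
    isCompact_variation_le fun n => ENNReal.div_ne_top ENNReal.coe_ne_top (weight_ne_zero _)
  have hKm : Monotone K := fun m m' h A hA n j => (hA n j).trans (by gcongr)
  have hu : Filter.Tendsto (fun m : ℕ => (R + 2) / ((m : NNReal) + 1)) Filter.atTop (𝓝 0) := by
    have := (tendsto_one_div_add_atTop_nhds_zero_nat (𝕜 := NNReal)).const_mul (R + 2)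
    simpa [div_eq_mul_inv] using this
  have hcomp := isCompact_setOfPred_probabilityMeasure_mass_eq_compl_isCompact_le hu hKc
    (Or.inr hKm)
  -- An argument of `γ` with a dyadic vector, and a precision `1 / (m + 1)`.
  let ι := {p : E d × Window d // ∀ i, IsDyadic (p.1 i)} × ℕ
  obtain ⟨P, -, hP⟩ := hcomp.inter_iInter_nonempty (fun q : ι => {P : ProbabilityMeasure (M d) |
      |∫ B, localCovariogram q.1.1.1 q.1.1.2 B ∂(P : Measure (M d)) - γ q.1.1.1 q.1.1.2| ≤
        1 / ((q.2 : ℝ) + 1)}) (fun q => isClosed_integral_localCovariogram _ _ _ _) (by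
    classical
    intro T
    -- A scale at which all the vectors are on the grid, and all the errors are small.
    obtain ⟨k, hk⟩ : ∃ k : ℕ, ∀ q ∈ T, (∀ i, ∃ l : ℤ, q.1.1.1 i = (2⁻¹ : ℝ) ^ k * l) ∧
        volume.real (Metric.cthickening ((d + 1) * (2⁻¹ : ℝ) ^ k) (frontier q.1.1.2.1)) <
          1 / (2 * ((q.2 : ℝ) + 1)) := by
      refine ((Finset.eventually_all T).2 fun q _ => ?_).exists (f := Filter.atTop)
      exact (Filter.eventually_all.2 q.1.2).and
        ((tendsto_volume_cthickening_frontier q.1.1.2).eventually_lt_const (by positivity))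
    obtain ⟨η, hη0, hη⟩ : ∃ η : ℝ, 0 < η ∧ ∀ q ∈ T, η < 1 / (2 * ((q.2 : ℝ) + 1)) := by
      have : ∀ᶠ η : ℝ in 𝓝[>] 0, 0 < η ∧ ∀ q ∈ T, η < 1 / (2 * ((q.2 : ℝ) + 1)) := by
        refine (eventually_mem_nhdsWithin).and ((Finset.eventually_all T).2 fun q _ => ?_)
        exact nhdsWithin_le_nhds (eventually_lt_nhds (by positivity))
      exact this.exists
    obtain ⟨Q, hQ, hQT, hQV⟩ := hγ.exists_approx_law hR (T.image fun q => q.1.1) k hη0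
    let Q' : ProbabilityMeasure (M d) := ⟨Q, hQ⟩
    refine ⟨Q', fun m => ?_, mem_iInter₂.2 fun q hq => ?_⟩
    · have h1 := measure_compl_variation_le Q hQV (c := ((m + 1 : NNReal) : ℝ≥0∞))
        (by simp) ENNReal.coe_ne_top
      rw [← ENNReal.coe_le_coe, ProbabilityMeasure.ennreal_coeFn_eq_coeFn_toMeasure,
        ENNReal.coe_div (by positivity), ENNReal.coe_add, ENNReal.coe_ofNat]
      exact h1
    · have h1 := hQT q.1.1 (Finset.mem_image_of_mem _ hq) (hk q hq).1
      have h2 := (hk q hq).2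
      have h3 := hη q hq
      have h4 : 1 / ((q.2 : ℝ) + 1) = 1 / (2 * ((q.2 : ℝ) + 1)) + 1 / (2 * ((q.2 : ℝ) + 1)) := by
        field_simp
        norm_num
      rw [mem_ofPred_eq, h4]
      exact h1.trans (add_le_add h2.le h3.le))
  refine ⟨P, inferInstance, fun y W hy => ?_⟩
  simp only [mem_iInter, mem_ofPred_eq] at hP
  rw [← sub_eq_zero, ← abs_eq_zero]
  refine le_antisymm (ge_of_tendsto' (tendsto_one_div_add_atTop_nhds_zero_nat (𝕜 := ℝ))
    fun m => hP (⟨(y, W), hy⟩, m)) (abs_nonneg _)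

/-! ### From dyadic vectors to all vectors -/

theorem abs_localCovariogram_sub_le (A : M d) {y u : E d} (hu0 : u ≠ 0) (hu : ∀ i, |u i| ≤ 1)
    {W : Window d} {n : ℕ+} (hn : (fun x => x - y) '' W.1 ⊆ cube d n) :
    |localCovariogram y W A - localCovariogram (y + u) W A| ≤
      ‖u‖ * sigma (fun y W => localCovariogram y W A) u
        ⟨cube d (n + 1), isWindow_cube d (n + 1)⟩ (cube_convex d (n + 1)) := by
  obtain ⟨S, hS, rfl⟩ := A.exists_rep
  rw [sigma_localCovariogram_mk hS, localCovariogram_mk, localCovariogram_mk, ← mul_assoc,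
    mul_one_div_cancel (norm_ne_zero_iff.2 hu0), one_mul]
  have hm : ∀ z : E d, MeasurableSet {x | x ∈ S ∧ x - z ∈ S ∧ x ∈ W.1} := fun z =>
    hS.inter ((hS.preimage (by fun_prop : Measurable fun x : E d => x - z)).inter W.measurableSet)
  have hf : ∀ z : E d, volume {x | x ∈ S ∧ x - z ∈ S ∧ x ∈ W.1} ≠ ∞ := fun z =>
    ((measure_mono fun x hx => hx.2.2).trans_lt W.volume_ne_top.lt_top).ne
  refine (abs_measureReal_sub_le_measureReal_symmDiff' (hm _).nullMeasurableSet
    (hm _).nullMeasurableSet (hf _) (hf _)).trans ?_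
  refine ENNReal.toReal_mono ((jumpVol_le S u _).trans_lt
    (isWindow_cube d (n + 1)).1.measure_lt_top).ne ?_
  rw [jumpVol, ← measure_preimage_add_right volume (-y)
    {x | x ∈ cube d (n + 1) ∧ x - u ∈ cube d (n + 1) ∧ ¬(x ∈ S ↔ x - u ∈ S)}]
  refine measure_mono fun x hx => ?_
  have hxW : x ∈ W.1 := by
    rcases hx with hx | hx
    · exact hx.1.2.2
    · exact hx.1.2.2
  have hxc : x - y ∈ cube d n := hn ⟨x, hxW, rfl⟩
  simp only [mem_preimage, mem_ofPred_eq, ← sub_eq_add_neg, sub_sub]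
  refine ⟨cube_mono (PNat.lt_add_right n 1).le hxc, ?_, fun h => ?_⟩
  · rw [← sub_sub]
    exact sub_mem_cube hxc hu
  · rcases hx with hx | hx
    · exact hx.2 ⟨hx.1.1, h.1 hx.1.2.1, hxW⟩
    · exact hx.2 ⟨hx.1.1, h.2 hx.1.2.1, hxW⟩

/-- The difference quotients of an admissible function control its increments, because this holds
for the covariogram of every set. -/
theorem Admissible.abs_sub_le {γ : E d → Window d → ℝ} (hγ : Admissible γ) {y u : E d}
    (hu0 : u ≠ 0) (hu : ∀ i, |u i| ≤ 1) {W : Window d} {n : ℕ+}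
    (hn : (fun x => x - y) '' W.1 ⊆ cube d n) :
    |γ y W - γ (y + u) W| ≤ ‖u‖ * sigma γ u
        ⟨cube d (n + 1), isWindow_cube d (n + 1)⟩ (cube_convex d (n + 1)) := by
  have hσ : ∀ g : E d → Window d → ℝ, ‖u‖ * sigma g u
      ⟨cube d (n + 1), isWindow_cube d (n + 1)⟩ (cube_convex d (n + 1)) =
      g 0 (erode ⟨cube d (n + 1), isWindow_cube d (n + 1)⟩ (cube_convex d (n + 1)) (-u) 0) -
      g u (erode ⟨cube d (n + 1), isWindow_cube d (n + 1)⟩ (cube_convex d (n + 1)) (-u) 0) +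
      g 0 (erode ⟨cube d (n + 1), isWindow_cube d (n + 1)⟩ (cube_convex d (n + 1)) 0 u) -
      g (-u) (erode ⟨cube d (n + 1), isWindow_cube d (n + 1)⟩ (cube_convex d (n + 1)) 0 u) := by
    intro g
    unfold sigma
    rw [← mul_assoc, mul_one_div_cancel (norm_ne_zero_iff.2 hu0), one_mul]
  have key : ∀ s : ℝ, |s| = 1 → s * (γ y W - γ (y + u) W) ≤ ‖u‖ * sigma γ u
        ⟨cube d (n + 1), isWindow_cube d (n + 1)⟩ (cube_convex d (n + 1)) := by
    intro s hs
    rw [hσ]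
    set C := erode ⟨cube d (n + 1), isWindow_cube d (n + 1)⟩ (cube_convex d (n + 1)) (-u) 0
    set D := erode ⟨cube d (n + 1), isWindow_cube d (n + 1)⟩ (cube_convex d (n + 1)) 0 u
    have h := hγ 6 (by norm_num) ![-s, s, 1, -1, 1, -1] ![y, y + u, 0, u, 0, -u]
      ![W, W, C, C, D, D] 0 (fun A => by
        have h1 := abs_localCovariogram_sub_le A hu0 hu hn
        rw [hσ fun y W => localCovariogram y W A] at h1
        have h2 : s * (localCovariogram y W A - localCovariogram (y + u) W A) ≤
            |localCovariogram y W A - localCovariogram (y + u) W A| := by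
          refine (le_abs_self _).trans ?_
          rw [abs_mul, hs, one_mul]
        simp [Fin.sum_univ_six]
        linarith)
    simp [Fin.sum_univ_six] at h
    linarith
  refine abs_le.2 ⟨?_, ?_⟩
  · linarith [key (-1) (by simp)]
  · linarith [key 1 (by simp)]

/-- An admissible function with finite constants `L_j` is Lipschitz in each coordinate. -/
theorem Admissible.exists_abs_sub_le {γ : E d → Window d → ℝ} (hγ : Admissible γ) (j : Fin d)
    (hL : ∀ n : ℕ+, L j γ ⟨cube d n, isWindow_cube d n⟩ (cube_convex d n) ≠ ∞) (y : E d)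
    (W : Window d) : ∃ C : ℝ, 0 ≤ C ∧ ∀ ε, 0 < ε → ε ≤ 1 →
      |γ y W - γ (y + ε • e j) W| ≤ ε * C := by
  obtain ⟨n, hn⟩ := exists_subset_cube (d := d) (U := (fun x => x - y) '' W.1)
    ((LipschitzWith.of_dist_le_mul (K := 1) fun a b => by simp).isBounded_image W.2.1)
  refine ⟨_, ENNReal.toReal_nonneg (a := L j γ ⟨cube d (n + 1), isWindow_cube d (n + 1)⟩
    (cube_convex d (n + 1))), fun ε hε0 hε1 => ?_⟩
  have h1 := hγ.abs_sub_le (y := y) (u := ε • e j) (by simp [hε0.ne'])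
    (abs_smul_e_le (by rwa [abs_of_pos hε0]) j) hn
  rw [norm_smul, norm_e, mul_one, Real.norm_of_nonneg hε0.le] at h1
  refine h1.trans (mul_le_mul_of_nonneg_left ?_ hε0.le)
  rw [← ENNReal.ofReal_le_iff_le_toReal (hL _)]
  exact le_iSup₂_of_le ε hε0.ne' le_rfl

/-- Two admissible functions with finite constants `L_j` that agree at dyadic vectors are equal.
The coordinates are made arbitrary one at a time. -/
theorem Admissible.eq_of_eq_dyadic {γ γ' : E d → Window d → ℝ} (hγ : Admissible γ)
    (hγ' : Admissible γ')
    (hL : ∀ j (n : ℕ+), L j γ ⟨cube d n, isWindow_cube d n⟩ (cube_convex d n) ≠ ∞)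
    (hL' : ∀ j (n : ℕ+), L j γ' ⟨cube d n, isWindow_cube d n⟩ (cube_convex d n) ≠ ∞)
    (h : ∀ y W, (∀ i, IsDyadic (y i)) → γ y W = γ' y W) (y : E d) (W : Window d) :
    γ y W = γ' y W := by
  suffices H : ∀ J : Finset (Fin d), ∀ y : E d, (∀ i ∉ J, IsDyadic (y i)) → γ y W = γ' y W from
    H Finset.univ y fun i hi => absurd (Finset.mem_univ i) hi
  intro J
  induction J using Finset.induction_on with
  | empty => exact fun y hy => h y W fun i => hy i (Finset.notMem_empty i)
  | insert j J hj ih =>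
    intro y hy
    obtain ⟨C, hC0, hC⟩ := hγ.exists_abs_sub_le j (hL j) y W
    obtain ⟨C', hC0', hC'⟩ := hγ'.exists_abs_sub_le j (hL' j) y W
    have hle : ∀ δ : ℝ, 0 < δ → δ ≤ 1 → |γ y W - γ' y W| ≤ δ * (C + C') := by
      intro δ hδ hδ1
      obtain ⟨ε, hε0, hεδ, hε⟩ := exists_isDyadic_add (y j) hδ
      have heq := ih (y + ε • e j) fun i hi => by
        by_cases hij : i = j
        · subst hij
          simpa using hε
        · have := hy i (by simp [hij, hi])
          simpa [hij] using this
      have h1 := hC ε hε0 (hεδ.trans hδ1)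
      have h2 := hC' ε hε0 (hεδ.trans hδ1)
      rw [← heq, abs_sub_comm] at h2
      calc _ ≤ _ := _root_.abs_sub_le _ (γ (y + ε • e j) W) _
        _ ≤ ε * (C + C') := by rw [mul_add]; exact add_le_add h1 h2
        _ ≤ _ := mul_le_mul_of_nonneg_right hεδ (by positivity)
    rw [← sub_eq_zero, ← abs_eq_zero]
    refine le_antisymm ?_ (abs_nonneg _)
    have hlim : Filter.Tendsto (fun m : ℕ => 1 / ((m : ℝ) + 1) * (C + C')) Filter.atTop (𝓝 0) := by
      simpa using (tendsto_one_div_add_atTop_nhds_zero_nat (𝕜 := ℝ)).mul_const (C + C')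
    refine ge_of_tendsto' hlim fun m => hle _ (by positivity) ?_
    rw [div_le_one (by positivity)]
    linarith [(Nat.cast_nonneg m : (0 : ℝ) ≤ m)]

theorem sigma_eq_of_eq_dyadic {γ γ' : E d → Window d → ℝ}
    (h : ∀ y W, (∀ i, IsDyadic (y i)) → γ y W = γ' y W) (m : ℕ) (j : Fin d) (W : Window d)
    (hc : Convex ℝ W.1) :
    sigma γ ((2⁻¹ : ℝ) ^ m • e j) W hc = sigma γ' ((2⁻¹ : ℝ) ^ m • e j) W hc := by
  unfold sigma
  rw [h 0 _ fun i => isDyadic_zero, h 0 _ fun i => isDyadic_zero,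
    h _ _ (isDyadic_smul_e m j), h (-((2⁻¹ : ℝ) ^ m • e j)) _ fun i => (isDyadic_smul_e m j i).neg]

/-! ### The mean perimeter -/

theorem lintegral_perBeta {Ω : Type*} [MeasurableSpace Ω] (P : Measure Ω) {X : Ω → M d}
    (hX : Measurable X) :
    ∫⁻ ω, perBeta (X ω) ∂P =
      ∑' n : ℕ+, weight d n * ∑ j, ∫⁻ ω, variation (e j) (cube d n) (X ω) ∂P := by
  have hm : ∀ (n : ℕ+) (j : Fin d), Measurable fun ω => variation (e j) (cube d n) (X ω) :=
    fun n j => (measurable_variation j ⟨cube d n, isWindow_cube d n⟩ (cube_convex d n)).comp hX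
  unfold perBeta perB
  rw [lintegral_tsum fun n =>
    ((Finset.measurable_sum _ fun j _ => hm n j).const_mul _).aemeasurable]
  refine tsum_congr fun n => ?_
  rw [lintegral_const_mul _ (Finset.measurable_sum _ fun j _ => hm n j),
    lintegral_finsetSum _ fun j _ => hm n j]

/-- An admissible function whose weighted sum of constants `L_j` is finite is the mean covariogram
of a law on `M d` whose mean perimeter is at most this sum. -/
theorem Admissible.exists_law_perBeta {γ : E d → Window d → ℝ} (hγ : Admissible γ) {R : ℝ≥0∞}
    (hRf : R ≠ ∞) (hR : ∑' n : ℕ+, weight d n *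
      ∑ j : Fin d, L j γ ⟨cube d n, isWindow_cube d n⟩ (cube_convex d n) ≤ R) :
    ∃ P : Measure (M d), IsProbabilityMeasure P ∧ (∀ y W, γ y W = meanCovariogram P id y W) ∧
      ∫⁻ A, perBeta A ∂P ≤ R := by
  obtain ⟨P, hP, hPγ⟩ := hγ.exists_law hRf hR
  have hV : ∀ j (n : ℕ+), ∫⁻ A, variation (e j) (cube d n) A ∂P ≤
      L j γ ⟨cube d n, isWindow_cube d n⟩ (cube_convex d n) := by
    intro j n
    refine (lintegral_variation P measurable_id j ⟨cube d n, isWindow_cube d n⟩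
      (cube_convex d n)).trans_le (iSup_le fun m => ?_)
    rw [sigma_eq_of_eq_dyadic hPγ]
    exact le_iSup₂_of_le ((2⁻¹ : ℝ) ^ m) (by positivity) le_rfl
  have hL : ∀ j (n : ℕ+), L j γ ⟨cube d n, isWindow_cube d n⟩ (cube_convex d n) ≠ ∞ := by
    intro j n htop
    have h1 := (ENNReal.le_tsum n).trans hR
    rw [ENNReal.sum_eq_top.2 ⟨j, Finset.mem_univ j, htop⟩,
      ENNReal.mul_top (weight_ne_zero n)] at h1
    exact hRf (top_le_iff.1 h1)
  refine ⟨P, hP, ?_, ?_⟩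
  · exact hγ.eq_of_eq_dyadic (admissible_meanCovariogram P measurable_id) hL
      (fun j n => (((L_meanCovariogram_le P measurable_id j _ _).trans (hV j n)).trans_lt
        (hL j n).lt_top).ne) fun y W hy => (hPγ y W hy).symm
  · refine (lintegral_perBeta P measurable_id).trans_le (le_trans (ENNReal.tsum_le_tsum fun n => ?_) hR)
    gcongr with j
    exact hV j n

end RAMS


theorem mainTheorem2 {d : ℕ} (γ : RAMS.E d → RAMS.Window d → ℝ) (r : ℝ) (hr : 0 ≤ r) :
    (∃ (Ω : Type*) (_ : MeasurableSpace Ω) (P : MeasureTheory.Measure Ω)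
        (_ : MeasureTheory.IsProbabilityMeasure P) (X : Ω → RAMS.M d),
        Measurable X ∧ (∀ y W, γ y W = RAMS.meanCovariogram P X y W) ∧
        ∫⁻ ω, RAMS.perBeta (X ω) ∂P ≤ ENNReal.ofReal r) ↔
      RAMS.Admissible γ ∧
        ∑' n : ℕ+, RAMS.weight d n *
          ∑ j : Fin d, RAMS.L j γ ⟨RAMS.cube d n, RAMS.isWindow_cube d n⟩ (RAMS.cube_convex d n)
            ≤ ENNReal.ofReal r := by
  constructor
  · rintro ⟨Ω, _, P, _, X, hX, hγ, hper⟩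
    obtain rfl : γ = RAMS.meanCovariogram P X := funext₂ hγ
    refine ⟨RAMS.admissible_meanCovariogram P hX, le_trans ?_ hper⟩
    rw [RAMS.lintegral_perBeta P hX]
    gcongr with n j
    exact RAMS.L_meanCovariogram_le P hX j _ _
  · rintro ⟨hadm, hL⟩
    obtain ⟨P, hP, hγ, hper⟩ := hadm.exists_law_perBeta ENNReal.ofReal_ne_top hL
    -- The law lives on the type `M d`, which is lifted to the universe of the statement.
    have hmp : MeasurePreserving ULift.down (P.map ULift.up) P :=
      ⟨measurable_down, by rw [Measure.map_map measurable_down measurable_up]; exact Measure.map_id⟩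
    refine ⟨ULift (RAMS.M d), inferInstance, P.map ULift.up,
      Measure.isProbabilityMeasure_map measurable_up.aemeasurable, ULift.down, measurable_down,
      fun y W => ?_, ?_⟩
    · rw [hγ y W]
      exact (hmp.integral_comp MeasurableEquiv.ulift.measurableEmbedding _).symm
    · rw [hmp.lintegral_comp_emb MeasurableEquiv.ulift.measurableEmbedding]
      exact hper
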